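/- **Setting.** Let $E, M \ge 1$ and $p$ be integers and $\alpha_{\mathrm{kn}}, \alpha_{\mathrm{ebh}} \in (0,1)$. For each environment $e \in [E]$ let $P^e$ be a distribution of $(X^e, Y^e) \in \mathbb{R}^p \times \mathbb{R}$, and let $H_j^{\mathrm{ci},e}$ be the hypothesis that $Y^e$ is independent of $X^e_j$ given $X^e_{-j}$. For $j \in [p]$ consider the consistent null $H_j^{\mathrm{cst}}$: $H_j^{\mathrm{ci},e}$ is true for some $e \in [E]$; and, for $r \in [E]$, the partial consistency null $H_j^{\mathrm{pcst},r}$: $|\{e \in [E] : H_j^{\mathrm{ci},e} \text{ is true}\}| > E - r$. Let $\mathcal{H}_0$ be the set of $j$ whose tested null is true. The data sets $(\mathbf{X}^e, \mathbf{Y}^e)$, $e\in[E]$, are independent, and $(\mathbf{X}^e,\mathbf{Y}^e)$ consists of $n_e$ i.i.d. draws from $P^e$. **Knockoffs.** In run $m \in [M]$, given the data and independently over $e$, a knockoff matrix $\tilde{\mathbf{X}}^{(e,m)}$ is drawn from a conditional distribution depending only on $\mathbf{X}^e$, for which the joint law of $(\mathbf{X}^e, \tilde{\mathbf{X}}^{(e,m)})$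 does not change when the columns $\mathbf{X}^e_j$ and $\tilde{\mathbf{X}}^{(e,m)}_j$ are exchanged, for each $j$. **Multi-environment statistics.** A random matrix $\mathbf{W} \in \mathbb{R}^{E \times p}$ is a valid multi-environment knockoff statistic if $\mathbf{W} \overset{d}{=} \mathbf{W} \odot \varepsilon$, where $\varepsilon$ is independent of $\mathbf{W}$ and has independent entries, $\varepsilon^e_j = \pm 1$ with probability $1/2$ each if $H_j^{\mathrm{ci},e}$ is true and $\varepsilon^e_j = 1$ otherwise. In run $m$ a matrix $\mathbf{W}^{(m)}$ is used that either is valid in this sense, or is a measurable function of $([\mathbf{X}^e,\tilde{\mathbf{X}}^{(e,m)}],\mathbf{Y}^e)_{e \in [E]}$ such that, for all $(e,j)$, exchanging $\mathbf{X}^e_j$ and $\tilde{\mathbf{X}}^{(e,m)}_j$ flips the sign of entry $(e,j)$ and leaves all other entries unchanged. **Algorithm (derandomized multi-environment knockoff filter).** For each run $m$, writing $\mathbf{W}=\mathbf{W}^{(m)}$: 1. When testing the $H_j^{\mathrm{cst}}$, set $W_j^{(m)} = \min_{e}\mathrm{sign}(\mathbf{W}_j^e)\cdot\prod_{e} |\mathbf{W}^e_j|$.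 When testing the $H_j^{\mathrm{pcst},r}$, set $W_j^{(m)} = \mathrm{sign}(\tfrac12 - p_j)\prod_{e=1}^r |\mathbf{W}_j|^{(E-e+1)}$, where $|\mathbf{W}_j|^{(k)}$ is the $k$-th largest of $|\mathbf{W}_j^1|,\dots,|\mathbf{W}_j^E|$ and $p_j = \Psi(n_j^- - 1, m_j, \tfrac12) + U_j\,\psi(n_j^-, m_j, \tfrac12)$. Here $n_j^-$ and $n_j^0$ are the numbers of negative and of zero entries in column $j$ of $\mathbf{W}$, $m_j = (E-r+1-n_j^0)\vee 0$, $\Psi(\cdot,k,\pi)$ and $\psi(\cdot,k,\pi)$ are the distribution function and the mass function of the binomial distribution with $k$ trials and success probability $\pi$, and $U_1,\dots,U_p$ are i.i.d. uniform on $[0,1]$ and independent of $\mathbf{W}^{(m)}$. 2. Let $T^{(m)}$ be the smallest $t \in \{|W^{(m)}_k| : k\in[p],\ W^{(m)}_k \ne 0\}$ for which $$\frac{1+\sum_{k} \mathbf{1}\{W_k^{(m)} \le -t\}}{\sum_{k} \mathbf{1}\{W_k^{(m)} \ge t\}} \le \alpha_{\mathrm{kn}} \quad\text{or}\quad \sum_{k}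 \mathbf{1}\{W_k^{(m)}\ge t\} < 1/\alpha_{\mathrm{kn}},$$ and $T^{(m)} = +\infty$ if there is none. 3. Set $e_j^{(m)} = p\,\mathbf{1}\{W_j^{(m)} \ge T^{(m)}\} \big/ \big(1+\sum_{k} \mathbf{1}\{W_k^{(m)} \le -T^{(m)}\}\big)$. Then let $e_j^{\mathrm{avg}} = \frac1M\sum_{m=1}^M e_j^{(m)}$, with $k$-th largest value $e^{\mathrm{avg}}_{(k)}$, let $\hat k$ be the largest $k\in[p]$ with $e^{\mathrm{avg}}_{(k)} \ge p/(\alpha_{\mathrm{ebh}} k)$, or $\hat k = 0$ if there is none, and select $\mathcal{S} = \{j : e_j^{\mathrm{avg}} \ge p/(\alpha_{\mathrm{ebh}}\hat k)\}$, with $\mathcal{S} = \emptyset$ if $\hat k = 0$. **Theorem.** When the consistent nulls $H_j^{\mathrm{cst}}$ are tested, and also when the partial consistency nulls $H_j^{\mathrm{pcst},r}$ are tested for any $r \in [E]$, the selected set satisfies $$\mathrm{FDR} = \mathbb{E}\left[\frac{|\mathcal{S}\cap\mathcal{H}_0|}{|\mathcal{S}|\vee 1}\right] \le \alpha_{\mathrm{ebh}}.$$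 -/

import Mathlib

open MeasureTheory ProbabilityTheory

noncomputable section

namespace MEKF

/-! ### Hypotheses -/

/-- Under the law `P` of `(X, Y)`, with `X` in `ℝ ^ p`, the response `Y` is conditionally
independent of the feature `X_j` given the remaining features `X_{-j}`. -/
def CINull {p : ℕ} (P : Measure ((Fin p → ℝ) × ℝ)) [IsFiniteMeasure P] (j : Fin p) : Prop :=
  CondIndepFun
    (MeasurableSpace.comap
      (fun (z : (Fin p → ℝ) × ℝ) (k : {k : Fin p // k ≠ j}) => z.1 k) inferInstance)
    (Measurable.comap_le (by fun_prop))
    (fun z : (Fin p → ℝ) × ℝ => z.2) (fun z : (Fin p → ℝ) × ℝ => z.1 j) P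

/-- The consistent conditional independence null: the conditional independence null holds in
at least one environment. -/
def CstNull {E p : ℕ} (P : Fin E → Measure ((Fin p → ℝ) × ℝ)) [∀ e, IsFiniteMeasure (P e)]
    (j : Fin p) : Prop :=
  ∃ e, CINull (P e) j

/-- The partial consistency null: the conditional independence null holds in more than `E - r`
environments. -/
def PcstNull {E p : ℕ} (P : Fin E → Measure ((Fin p → ℝ) × ℝ)) [∀ e, IsFiniteMeasure (P e)]
    (r : ℕ) (j : Fin p) : Prop :=
  E - r < Set.ncard {e : Fin E | CINull (P e) j}

/-! ### Data and knockoffs -/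

/-- A covariate matrix with `n` rows (samples) and `p` columns (features). -/
abbrev CovMat (n p : ℕ) : Type := Fin n → Fin p → ℝ

/-- The data `(𝐗, 𝐘)` of one environment, stored by rows `(X_i, Y_i)`. -/
abbrev EnvData (n p : ℕ) : Type := Fin n → (Fin p → ℝ) × ℝ

/-- The covariate matrix of the data of one environment. -/
def EnvData.cov {n p : ℕ} (z : EnvData n p) : CovMat n p := fun i => (z i).1

theorem measurable_cov {n p : ℕ} : Measurable (EnvData.cov : EnvData n p → CovMat n p) := by
  unfold EnvData.cov
  fun_prop

/-- Exchange the `j`-th columns of two covariate matrices. -/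
def swapCol {n p : ℕ} (j : Fin p) (x : CovMat n p × CovMat n p) : CovMat n p × CovMat n p :=
  (fun i k => if k = j then x.2 i k else x.1 i k, fun i k => if k = j then x.1 i k else x.2 i k)

/-- `K` is a valid conditional distribution of the knockoff matrix given the covariate matrix
when the latter has law `Q`: if `𝐗 ∼ Q` and `𝐗̃ | 𝐗 ∼ K 𝐗`, then exchanging `𝐗_j` and `𝐗̃_j` does
not change the joint law of `(𝐗, 𝐗̃)`, for each feature `j`. -/
def IsKnockoffKernel {n p : ℕ} (Q : Measure (CovMat n p)) (K : Kernel (CovMat n p) (CovMat n p)) :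
    Prop :=
  ∀ j : Fin p, (Q ⊗ₘ K).map (swapCol j) = Q ⊗ₘ K

/-- The data of one environment together with a knockoff matrix, `([𝐗, 𝐗̃], 𝐘)`. -/
abbrev AugData (n p : ℕ) : Type := EnvData n p × CovMat n p

/-- Exchange `𝐗_j` and `𝐗̃_j` in `([𝐗, 𝐗̃], 𝐘)`. -/
def AugData.swap {n p : ℕ} (j : Fin p) (d : AugData n p) : AugData n p :=
  (fun i => ((swapCol j (d.1.cov, d.2)).1 i, (d.1 i).2), (swapCol j (d.1.cov, d.2)).2)

/-- The law of `([𝐗, 𝐗̃], 𝐘)` in one environment: the `n` rows `(X_i, Y_i)` are i.i.d. from `P`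
and, conditionally on `(𝐗, 𝐘)`, the knockoff matrix is drawn from `K 𝐗`. -/
def augLaw {p : ℕ} (n : ℕ) (P : Measure ((Fin p → ℝ) × ℝ))
    (K : Kernel (CovMat n p) (CovMat n p)) : Measure (AugData n p) :=
  (Measure.pi fun _ : Fin n => P) ⊗ₘ (K.comap EnvData.cov measurable_cov)

/-! ### Multi-environment knockoff statistics -/

/-- The law of a random sign, `±1` with probability `1/2` each. -/
def fairSign : Measure ℝ :=
  (2⁻¹ : ENNReal) • Measure.dirac 1 + (2⁻¹ : ENNReal) • Measure.dirac (-1)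

open Classical in
/-- The law of the random sign matrix `ε` with independent entries, `ε^e_j` being `±1` with
probability `1/2` if the conditional independence null `(e, j)` is true, and `+1` otherwise. -/
def signMatrixLaw {E p : ℕ} (P : Fin E → Measure ((Fin p → ℝ) × ℝ))
    [∀ e, IsFiniteMeasure (P e)] : Measure (Fin E → Fin p → ℝ) :=
  Measure.pi fun e => Measure.pi fun j =>
    if CINull (P e) j then fairSign else Measure.dirac 1

/-- The random matrix `w` is a valid multi-environment knockoff statistic: `w` has the same law
as the entrywise product `w ⊙ ε`, where `ε` is independent of `w`. -/
def IsValidStat {Ω : Type*} [MeasurableSpace Ω] (μ : Measure Ω) {E p : ℕ}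
    (P : Fin E → Measure ((Fin p → ℝ) × ℝ)) [∀ e, IsFiniteMeasure (P e)]
    (w : Ω → Fin E → Fin p → ℝ) : Prop :=
  ((μ.map w).prod (signMatrixLaw P)).map (fun q => q.1 * q.2) = μ.map w

/-- The flip-sign property of a multi-environment statistic computed from
`([𝐗^e, 𝐗̃^e], 𝐘^e)_e`: swapping `𝐗^e_j` and `𝐗̃^e_j` changes the sign of the entry `(e, j)` and
leaves the other entries as they are. -/
def FlipSign {E p : ℕ} {n : Fin E → ℕ} (F : (∀ e, AugData (n e) p) → Fin E → Fin p → ℝ) : Prop :=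
  ∀ (d : ∀ e, AugData (n e) p) (e : Fin E) (j : Fin p) (e' : Fin E) (j' : Fin p),
    F (Function.update d e ((d e).swap j)) e' j' =
      if e' = e ∧ j' = j then -F d e' j' else F d e' j'

/-- The `k`-th largest of the numbers `a 1, …, a n` (for `1 ≤ k ≤ n`): the largest `x` such that
at least `k` of them are `≥ x`. -/
def kthLargest {n : ℕ} (a : Fin n → ℝ) (k : ℕ) : ℝ :=
  sSup {x : ℝ | k ≤ (Finset.univ.filter fun i => x ≤ a i).card}

/-- The feature statistics for the consistent hypotheses. -/
def cstStat {E p : ℕ} (w : Fin E → Fin p → ℝ) (j : Fin p) : ℝ :=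
  ((Finset.univ.inf fun e => SignType.sign (w e j) : SignType) : ℝ) * ∏ e, |w e j|

/-- The number of negative entries in the `j`-th column. -/
def numNeg {E p : ℕ} (w : Fin E → Fin p → ℝ) (j : Fin p) : ℕ :=
  (Finset.univ.filter fun e => w e j < 0).card

/-- The number of zero entries in the `j`-th column. -/
def numZero {E p : ℕ} (w : Fin E → Fin p → ℝ) (j : Fin p) : ℕ :=
  (Finset.univ.filter fun e => w e j = 0).card

/-- The mass at `i` of the binomial distribution with `m` trials and success probability `1/2`. -/
def binomMass (i m : ℕ) : ℝ := (m.choose i : ℝ) * (1 / 2) ^ m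

/-- `p_j = Ψ(n⁻ - 1, m, 1/2) + u ψ(n⁻, m, 1/2)` with `m = (E - r + 1 - n⁰) ∨ 0`, where `Ψ` and `ψ`
are the binomial distribution function and mass function; the sum over `i < n⁻` is the value
of `Ψ` at `n⁻ - 1`. -/
def pcstPValue {E p : ℕ} (r : ℕ) (w : Fin E → Fin p → ℝ) (u : Fin p → ℝ) (j : Fin p) : ℝ :=
  ∑ i ∈ Finset.range (numNeg w j), binomMass i (E - r + 1 - numZero w j) +
    u j * binomMass (numNeg w j) (E - r + 1 - numZero w j)

/-- The feature statistics for the partial consistency hypotheses. -/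
def pcstStat {E p : ℕ} (r : ℕ) (w : Fin E → Fin p → ℝ) (u : Fin p → ℝ) (j : Fin p) : ℝ :=
  (SignType.sign (1 / 2 - pcstPValue r w u j) : ℝ) *
    ∏ e ∈ Finset.Icc 1 r, kthLargest (fun e' => |w e' j|) (E - e + 1)

/-! ### Knockoff threshold, e-values, e-BH -/

/-- The stopping criterion at level `t`. If no `W_k` is `≥ t`, the ratio is infinite in the usual
convention; the second alternative then holds anyway. -/
def StopAt {p : ℕ} (α : ℝ) (W : Fin p → ℝ) (t : ℝ) : Prop :=
  (1 + ((Finset.univ.filter fun k => W k ≤ -t).card : ℝ)) /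
      ((Finset.univ.filter fun k => t ≤ W k).card : ℝ) ≤ α ∨
    ((Finset.univ.filter fun k => t ≤ W k).card : ℝ) < 1 / α

open Classical in
/-- The knockoff threshold: the smallest of the nonzero magnitudes `|W_k|` at which the stopping
criterion holds, and `⊤` if there is none. -/
def threshold {p : ℕ} (α : ℝ) (W : Fin p → ℝ) : WithTop ℝ :=
  ((Finset.univ.image fun k => |W k|).filter fun t => 0 < t ∧ StopAt α W t).min

open Classical in
/-- The knockoff e-values `p 1{W_j ≥ T} / (1 + #{k : W_k ≤ -T})`. -/
def eValue {p : ℕ} (α : ℝ) (W : Fin p → ℝ) (j : Fin p) : ℝ :=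
  p * (if threshold α W ≤ (W j : WithTop ℝ) then 1 else 0) /
    (1 + ((Finset.univ.filter fun k => threshold α W ≤ ((-W k : ℝ) : WithTop ℝ)).card : ℝ))

/-- The average over the `M` runs of the e-values computed from the feature statistics
`W 1, …, W M`. -/
def avgEValue {M p : ℕ} (α : ℝ) (W : Fin M → Fin p → ℝ) (j : Fin p) : ℝ :=
  (1 / M : ℝ) * ∑ m, eValue α (W m) j

open Classical in
/-- The number of e-BH rejections: the largest `k` in `{1, …, p}` such that the `k`-th largest
e-value is at least `p / (α k)`, and `0` if there is none. -/
def ebhCount {p : ℕ} (α : ℝ) (v : Fin p → ℝ) : ℕ :=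
  ((Finset.Icc 1 p).filter fun k => (p : ℝ) / (α * k) ≤ kthLargest v k).sup id

open Classical in
/-- The e-BH selection; it is empty if `ebhCount` is `0`. -/
def ebhSelect {p : ℕ} (α : ℝ) (v : Fin p → ℝ) : Finset (Fin p) :=
  Finset.univ.filter fun j => 0 < ebhCount α v ∧ (p : ℝ) / (α * ebhCount α v) ≤ v j

/-- The selected set of the derandomized filter, from the feature statistics of the `M` runs. -/
def derandSelect {M p : ℕ} (αkn αebh : ℝ) (W : Fin M → Fin p → ℝ) : Finset (Fin p) :=
  ebhSelect αebh (avgEValue αkn W)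

/-! ### False discovery rate -/

open Classical in
/-- The false discovery proportion `|S ∩ H₀| / (|S| ∨ 1)`. -/
def fdp {p : ℕ} (H0 : Set (Fin p)) (S : Finset (Fin p)) : ℝ :=
  ((S.filter fun j => j ∈ H0).card : ℝ) / max (S.card : ℝ) 1

/-- The random selected set `S` has false discovery rate at most `α`: the false discovery
proportion is integrable and its expectation is at most `α`. -/
def ControlsFDR {Ω : Type*} [MeasurableSpace Ω] (μ : Measure Ω) {p : ℕ} (H0 : Set (Fin p))
    (S : Ω → Finset (Fin p)) (α : ℝ) : Prop :=
  Integrable (fun ω => fdp H0 (S ω)) μ ∧ ∫ ω, fdp H0 (S ω) ∂μ ≤ α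

end MEKF

end

noncomputable section

namespace MEKF

/-! ### Leave-one-out analysis of the knockoff threshold -/

/-! Two reductions lead to sign symmetry of single entries. The first is pointwise: every index
selected by e-BH has an e-value of at least `p / (α k̂)`, and at least `k̂` indices are selected, so
the false discovery proportion is at most `α / p` times the sum of the null e-values
(`fdp_ebhSelect_le`). Hence it suffices that in each run the null e-values have total expectation at
most `p`. Averaging over runs uses only linearity, whatever the dependence between runs.

The second concerns one run. If `W_j > 0`, its e-value is `p` times `negWeight` at `j`, evaluated
after reversing the sign of `W_j` (`eValue_eq_negWeight`). These weights sum to at most one for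
every vector, because the leave-one-out thresholds agree at all indices of nonzero weight
(`sum_negWeight_le_one`). If a measure preserving map reverses a positive null `W_j` and fixes the
other statistics, the expected e-value of `j` is at most `p` times its expected weight; summing
gives `p` (`sum_integral_eValue_le`). Only positive values need to be reversed, which matters
because the combined statistics need not have symmetric signs.

Such maps come from `FlipInvariant`. For a valid matrix the flip is absorbed by `ε`; for a matrix
computed from data it becomes a knockoff swap, which preserves the law under conditional
independence. For the consistent null one null entry of the column is flipped. For the partial
consistency null, `E - r + 1` null entries are flipped and `U_j` is replaced by `1 - U_j`;
monotonicity and symmetry of the randomized binomial p-value then move `p_j` from below to above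
`1/2` (`pcstStat_flipReflect`). -/

theorem threshold_le_iff {p : ℕ} {α : ℝ} {W : Fin p → ℝ} {x : ℝ} :
    threshold α W ≤ (x : WithTop ℝ) ↔
      ∃ k, 0 < |W k| ∧ StopAt α W |W k| ∧ |W k| ≤ x := by
  classical
  constructor
  · intro h
    obtain ⟨t, ht, htx⟩ := WithTop.le_coe_iff.1 h
    have hmem := Finset.mem_of_min ht
    simp only [Finset.mem_filter, Finset.mem_image, Finset.mem_univ, true_and] at hmem
    obtain ⟨⟨k, rfl⟩, h0, hs⟩ := hmem
    exact ⟨k, h0, hs, htx⟩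
  · rintro ⟨k, h0, hs, hx⟩
    refine le_trans (Finset.min_le (a := |W k|) ?_) (WithTop.coe_le_coe.2 hx)
    simp only [Finset.mem_filter, Finset.mem_image, Finset.mem_univ, true_and]
    exact ⟨⟨k, rfl⟩, h0, hs⟩

theorem pos_of_threshold_le {p : ℕ} {α : ℝ} {W : Fin p → ℝ} {x : ℝ}
    (h : threshold α W ≤ (x : WithTop ℝ)) : 0 < x := by
  obtain ⟨k, h0, -, hx⟩ := threshold_le_iff.1 h
  exact h0.trans_le hx

/-- The statistics `W` with the sign of the `j`-th one made nonnegative. -/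
def absUpdate {p : ℕ} (W : Fin p → ℝ) (j : Fin p) : Fin p → ℝ := Function.update W j |W j|

theorem absUpdate_self {p : ℕ} (W : Fin p → ℝ) (j : Fin p) : absUpdate W j j = |W j| := by
  simp [absUpdate]

theorem absUpdate_of_ne {p : ℕ} (W : Fin p → ℝ) {j k : Fin p} (h : k ≠ j) :
    absUpdate W j k = W k := by
  simp [absUpdate, h]

theorem abs_absUpdate {p : ℕ} (W : Fin p → ℝ) (j k : Fin p) : |absUpdate W j k| = |W k| := by
  by_cases h : k = j
  · subst h; simp [absUpdate_self]
  · rw [absUpdate_of_ne W h]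

theorem absUpdate_of_nonneg {p : ℕ} {W : Fin p → ℝ} {j : Fin p} (h : 0 ≤ W j) :
    absUpdate W j = W := by
  simp [absUpdate, abs_of_nonneg h]

theorem absUpdate_update_neg {p : ℕ} (W : Fin p → ℝ) (j : Fin p) :
    absUpdate (Function.update W j (-W j)) j = absUpdate W j := by
  simp [absUpdate]

/-- Making `W k` nonnegative moves exactly one index from the lower count to the upper one. The
right-hand side no longer mentions `k`, which is what makes different leave-one-out thresholds
comparable. -/
theorem stopAt_absUpdate_iff {p : ℕ} {α t : ℝ} {W : Fin p → ℝ} {k : Fin p} (ht : 0 < t)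
    (hk : t ≤ -W k) :
    StopAt α (absUpdate W k) t ↔
      ((Finset.univ.filter fun i => W i ≤ -t).card : ℝ) /
        ((Finset.univ.filter fun i => t ≤ W i).card + 1 : ℝ) ≤ α ∨
      ((Finset.univ.filter fun i => t ≤ W i).card + 1 : ℝ) < 1 / α := by
  classical
  have hneg : (Finset.univ.filter fun i => absUpdate W k i ≤ -t) =
      (Finset.univ.filter fun i => W i ≤ -t).erase k := by
    ext i
    by_cases hi : i = k
    · subst hi
      simp only [Finset.mem_filter, Finset.mem_univ, true_and, absUpdate_self, Finset.mem_erase,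
        ne_eq, not_true_eq_false, false_and, iff_false, not_le]
      linarith [abs_nonneg (W i)]
    · simp [absUpdate_of_ne W hi, hi]
  have hpos : (Finset.univ.filter fun i => t ≤ absUpdate W k i) =
      insert k (Finset.univ.filter fun i => t ≤ W i) := by
    ext i
    by_cases hi : i = k
    · subst hi
      simp only [Finset.mem_filter, Finset.mem_univ, true_and, absUpdate_self,
        Finset.mem_insert, true_or, iff_true]
      exact hk.trans (neg_le_abs _)
    · simp [absUpdate_of_ne W hi, hi]
  have h1 : (((Finset.univ.filter fun i => W i ≤ -t).erase k).card : ℝ) + 1 =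
      ((Finset.univ.filter fun i => W i ≤ -t).card : ℝ) := by
    exact_mod_cast Finset.card_erase_add_one (by simpa using (by linarith : W k ≤ -t))
  have h2 : ((insert k (Finset.univ.filter fun i => t ≤ W i)).card : ℝ) =
      ((Finset.univ.filter fun i => t ≤ W i).card : ℝ) + 1 := by
    rw [Finset.card_insert_of_notMem (by simp; linarith)]
    push_cast; rfl
  rw [StopAt, hneg, hpos, h2, ← h1, add_comm (1 : ℝ)]

/-- The hypotheses are symmetric in `j` and `k`, so the two thresholds are in fact equal. -/
theorem threshold_absUpdate_le {p : ℕ} {α : ℝ} {W : Fin p → ℝ} {j k : Fin p}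
    (hj : threshold α (absUpdate W j) ≤ ((-W j : ℝ) : WithTop ℝ))
    (hk : threshold α (absUpdate W k) ≤ ((-W k : ℝ) : WithTop ℝ)) :
    threshold α (absUpdate W k) ≤ threshold α (absUpdate W j) := by
  by_contra! hlt
  obtain ⟨t, ht, htj⟩ := WithTop.le_coe_iff.1 hj
  have htk : t ≤ -W k := by
    have := hlt.le.trans hk
    rw [ht] at this
    exact WithTop.coe_le_coe.1 this
  have h1 : threshold α (absUpdate W j) ≤ (t : WithTop ℝ) := ht.le
  obtain ⟨i, h0, hs, hi⟩ := threshold_le_iff.1 h1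
  have hit : |absUpdate W j i| = t := by
    refine le_antisymm hi (WithTop.coe_le_coe.1 ?_)
    calc (t : WithTop ℝ) = threshold α (absUpdate W j) := ht.symm
      _ ≤ _ := threshold_le_iff.2 ⟨i, h0, hs, le_rfl⟩
  rw [hit] at h0 hs
  -- Both `t ≤ -W j` and `t ≤ -W k` hold, so the criterion at `t` is the same for the two modified
  -- vectors.
  rw [stopAt_absUpdate_iff h0 htj, ← stopAt_absUpdate_iff h0 htk] at hs
  refine absurd hlt (not_lt.2 ?_)
  rw [ht]
  refine threshold_le_iff.2 ⟨i, ?_⟩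
  rw [abs_absUpdate] at hit ⊢
  rw [hit]
  exact ⟨h0, hs, le_rfl⟩

open Classical in
/-- The reciprocal of one plus the number of statistics, other than the `j`-th, which are at most
minus the leave-one-out threshold. -/
def looWeight {p : ℕ} (α : ℝ) (W : Fin p → ℝ) (j : Fin p) : ℝ :=
  (1 + ((Finset.univ.filter fun k => k ≠ j ∧
    threshold α (absUpdate W j) ≤ ((-W k : ℝ) : WithTop ℝ)).card : ℝ))⁻¹

open Classical in
/-- The leave-one-out weight of `j` if `W_j` is at most minus the leave-one-out threshold. -/
def negWeight {p : ℕ} (α : ℝ) (W : Fin p → ℝ) (j : Fin p) : ℝ :=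
  if threshold α (absUpdate W j) ≤ ((-W j : ℝ) : WithTop ℝ) then looWeight α W j else 0

theorem looWeight_pos {p : ℕ} (α : ℝ) (W : Fin p → ℝ) (j : Fin p) : 0 < looWeight α W j := by
  rw [looWeight]; positivity

theorem negWeight_nonneg {p : ℕ} (α : ℝ) (W : Fin p → ℝ) (j : Fin p) : 0 ≤ negWeight α W j := by
  rw [negWeight]
  split_ifs
  · exact (looWeight_pos _ _ _).le
  · exact le_rfl

theorem looWeight_update_neg {p : ℕ} (α : ℝ) (W : Fin p → ℝ) (j : Fin p) :
    looWeight α (Function.update W j (-W j)) j = looWeight α W j := by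
  rw [looWeight, looWeight, absUpdate_update_neg]
  congr 4
  ext k
  simp only [Finset.mem_filter, Finset.mem_univ, true_and]
  exact and_congr_right fun hk => by rw [Function.update_of_ne hk]

/-- All indices of `J` share one threshold, so each of them counts all the others in its denominator
and has weight at most `1 / |J|`. -/
theorem sum_negWeight_le_one {p : ℕ} (α : ℝ) (W : Fin p → ℝ) : ∑ j, negWeight α W j ≤ 1 := by
  classical
  set J := Finset.univ.filter fun j =>
    threshold α (absUpdate W j) ≤ ((-W j : ℝ) : WithTop ℝ) with hJ
  have hsum : ∑ j, negWeight α W j = ∑ j ∈ J, looWeight α W j := by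
    rw [hJ, Finset.sum_filter]; rfl
  have hle : ∀ j ∈ J, looWeight α W j ≤ (J.card : ℝ)⁻¹ := by
    intro j hj
    have hj' := (Finset.mem_filter.1 hj).2
    have hcard : (J.card : ℝ) ≤ 1 + ((Finset.univ.filter fun k => k ≠ j ∧
        threshold α (absUpdate W j) ≤ ((-W k : ℝ) : WithTop ℝ)).card : ℝ) := by
      rw [← Finset.card_erase_add_one hj, Nat.cast_add, Nat.cast_one, add_comm]
      gcongr
      intro k hk
      obtain ⟨hkj, hk⟩ := Finset.mem_erase.1 hk
      have hk' := (Finset.mem_filter.1 hk).2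
      simp only [Finset.mem_filter, Finset.mem_univ, true_and]
      exact ⟨hkj, (threshold_absUpdate_le hk' hj').trans hk'⟩
    have hpos : (0 : ℝ) < J.card := by exact_mod_cast Finset.card_pos.2 ⟨j, hj⟩
    exact inv_anti₀ hpos hcard
  rw [hsum]
  calc ∑ j ∈ J, looWeight α W j ≤ ∑ _j ∈ J, (J.card : ℝ)⁻¹ := Finset.sum_le_sum hle
    _ = J.card * (J.card : ℝ)⁻¹ := by simp
    _ ≤ 1 := mul_inv_le_one

/-! ### E-values in terms of leave-one-out weights. -/

theorem eValue_nonneg {p : ℕ} (α : ℝ) (W : Fin p → ℝ) (j : Fin p) : 0 ≤ eValue α W j := by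
  rw [eValue]; positivity

theorem eValue_le {p : ℕ} (α : ℝ) (W : Fin p → ℝ) (j : Fin p) : eValue α W j ≤ p := by
  rw [eValue]
  refine div_le_of_le_mul₀ (by positivity) (by positivity) ?_
  refine mul_le_mul_of_nonneg_left ?_ (by positivity)
  split_ifs <;> linarith [Nat.cast_nonneg (α := ℝ) (Finset.univ.filter fun k =>
    threshold α W ≤ ((-W k : ℝ) : WithTop ℝ)).card]

theorem eValue_eq_zero_of_nonpos {p : ℕ} {α : ℝ} {W : Fin p → ℝ} {j : Fin p} (h : W j ≤ 0) :
    eValue α W j = 0 := by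
  have : ¬ threshold α W ≤ (W j : WithTop ℝ) := fun h' => (pos_of_threshold_le h').not_ge h
  simp [eValue, this]

/-- Restoring the sign of a flipped positive entry returns `W` itself, so the leave-one-out
threshold of the flipped vector is the true threshold. -/
theorem eValue_eq_negWeight {p : ℕ} {α : ℝ} {W : Fin p → ℝ} {j : Fin p} (h : 0 < W j) :
    eValue α W j = p * negWeight α (Function.update W j (-W j)) j := by
  classical
  rw [negWeight, absUpdate_update_neg, absUpdate_of_nonneg h.le, looWeight_update_neg,
    Function.update_self, neg_neg, eValue, looWeight, absUpdate_of_nonneg h.le]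
  -- The threshold is positive and `W j > 0`, so `j` is never counted and the restriction `k ≠ j`
  -- costs nothing.
  have : (Finset.univ.filter fun k => k ≠ j ∧ threshold α W ≤ ((-W k : ℝ) : WithTop ℝ)) =
      Finset.univ.filter fun k => threshold α W ≤ ((-W k : ℝ) : WithTop ℝ) := by
    ext k
    simp only [Finset.mem_filter, Finset.mem_univ, true_and, and_iff_right_iff_imp]
    rintro hk rfl
    linarith [pos_of_threshold_le hk]
  rw [this]
  split_ifs <;> simp [div_eq_mul_inv]

/-! ### The e-BH selection -/

/-- The supremum is attained: raising `y` to the smallest `a i` above it does not change the count,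
so only the finitely many values `a i` compete. The bounds on `k` keep the set bounded above and
nonempty; otherwise `sSup` would take its default value `0`. -/
theorem le_kthLargest_iff {n : ℕ} {a : Fin n → ℝ} {k : ℕ} (hk : 1 ≤ k) (hkn : k ≤ n) {x : ℝ} :
    x ≤ kthLargest a k ↔ k ≤ (Finset.univ.filter fun i => x ≤ a i).card := by
  classical
  have hex : ∀ y ∈ {x : ℝ | k ≤ (Finset.univ.filter fun i => x ≤ a i).card},
      ∃ i, y ≤ a i ∧ k ≤ (Finset.univ.filter fun l => a i ≤ a l).card := by
    intro y hy
    have hy' : k ≤ (Finset.univ.filter fun i => y ≤ a i).card := hy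
    have hne : (Finset.univ.filter fun i => y ≤ a i).Nonempty :=
      Finset.card_pos.1 (by omega)
    obtain ⟨i, hi, hmin⟩ := Finset.exists_min_image _ a hne
    refine ⟨i, (Finset.mem_filter.1 hi).2, hy'.trans (Finset.card_le_card fun l hl => ?_)⟩
    exact Finset.mem_filter.2 ⟨Finset.mem_univ _, hmin l hl⟩
  have hbdd : BddAbove {x : ℝ | k ≤ (Finset.univ.filter fun i => x ≤ a i).card} := by
    obtain ⟨B, hB⟩ := (Set.finite_range a).bddAbove
    refine ⟨B, fun y hy => ?_⟩
    obtain ⟨i, hi, -⟩ := hex y hy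
    exact hi.trans (hB ⟨i, rfl⟩)
  constructor
  · intro hx
    have hne : {x : ℝ | k ≤ (Finset.univ.filter fun i => x ≤ a i).card}.Nonempty := by
      obtain ⟨B, hB⟩ := (Set.finite_range a).bddBelow
      refine ⟨B, ?_⟩
      have : (Finset.univ.filter fun i => B ≤ a i) = Finset.univ :=
        Finset.filter_true_of_mem fun i _ => hB ⟨i, rfl⟩
      simpa [this] using hkn
    have hfin : {y | ∃ i, y = a i ∧ k ≤ (Finset.univ.filter fun l => a i ≤ a l).card}.Finite :=
      (Set.finite_range a).subset (by rintro _ ⟨i, rfl, -⟩; exact ⟨i, rfl⟩)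
    obtain ⟨y0, hy0⟩ := hne
    obtain ⟨i0, -, hi0⟩ := hex y0 hy0
    obtain ⟨z, ⟨i, rfl, hi⟩, hzmax⟩ := hfin.exists_maximal ⟨a i0, i0, rfl, hi0⟩
    have hle : kthLargest a k ≤ a i := by
      refine csSup_le ⟨y0, hy0⟩ fun y hy => ?_
      obtain ⟨l, hl, hl'⟩ := hex y hy
      refine hl.trans ?_
      by_contra! hcon
      exact absurd (hzmax ⟨l, rfl, hl'⟩ hcon.le) (not_le.2 hcon)
    exact hi.trans (Finset.card_le_card fun l hl =>
      Finset.mem_filter.2 ⟨Finset.mem_univ _, (hx.trans hle).trans (Finset.mem_filter.1 hl).2⟩)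
  · intro hx
    exact le_csSup hbdd hx

/-- Self-consistency of e-BH: the `k̂`-th largest e-value passes the cutoff, hence so do at least
`k̂` of them. -/
theorem ebhCount_le_card {p : ℕ} (α : ℝ) (v : Fin p → ℝ) (h : 0 < ebhCount α v) :
    ebhCount α v ≤ (ebhSelect α v).card := by
  classical
  have hne : ((Finset.Icc 1 p).filter fun k : ℕ =>
      (p : ℝ) / (α * k) ≤ kthLargest v k).Nonempty := by
    by_contra hcon
    rw [Finset.not_nonempty_iff_eq_empty] at hcon
    simp [ebhCount, hcon] at h
  obtain ⟨k, hk, hks⟩ := Finset.exists_mem_eq_sup _ hne id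
  have hck : ebhCount α v = k := hks
  simp only [Finset.mem_filter, Finset.mem_Icc] at hk
  have := (le_kthLargest_iff hk.1.1 hk.1.2).1 hk.2
  rw [ebhSelect, hck]
  simpa [show 0 < k from hk.1.1] using this

theorem fdp_nonneg {p : ℕ} (H0 : Set (Fin p)) (S : Finset (Fin p)) : 0 ≤ fdp H0 S := by
  rw [fdp]; positivity

theorem fdp_le_one {p : ℕ} (H0 : Set (Fin p)) (S : Finset (Fin p)) : fdp H0 S ≤ 1 := by
  classical
  rw [fdp]
  refine div_le_one_of_le₀ (le_max_of_le_left ?_) (by positivity)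
  exact_mod_cast Finset.card_filter_le _ _

open Classical in
/-- Pointwise bound of the false discovery proportion of e-BH by the null e-values. -/
theorem fdp_ebhSelect_le {p : ℕ} {α : ℝ} (hα : 0 < α) (H0 : Set (Fin p)) {v : Fin p → ℝ}
    (hv : ∀ j, 0 ≤ v j) :
    fdp H0 (ebhSelect α v) ≤ α / p * ∑ j ∈ Finset.univ.filter (· ∈ H0), v j := by
  rcases Nat.eq_zero_or_pos (ebhCount α v) with h0 | hpos
  · have : ebhSelect α v = ∅ := by simp [ebhSelect, h0]
    rw [this]
    simp only [fdp, Finset.filter_empty, Finset.card_empty, Nat.cast_zero, zero_div]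
    exact mul_nonneg (by positivity) (Finset.sum_nonneg fun j _ => hv j)
  have hcard := ebhCount_le_card α v hpos
  have hk : (0 : ℝ) < ebhCount α v := by exact_mod_cast hpos
  have hcard' : (ebhCount α v : ℝ) ≤ (ebhSelect α v).card := by exact_mod_cast hcard
  have hp : (0 : ℝ) < p := by
    have := hpos.trans_le (hcard.trans (Finset.card_le_univ _))
    simpa using this
  calc fdp H0 (ebhSelect α v)
      ≤ (((ebhSelect α v).filter fun j => j ∈ H0).card : ℝ) / ebhCount α v := by
        rw [fdp]
        exact div_le_div_of_nonneg_left (by positivity) hk (le_max_of_le_left hcard')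
    _ = ∑ j ∈ (ebhSelect α v).filter (· ∈ H0), (1 / ebhCount α v : ℝ) := by
        rw [Finset.sum_const, nsmul_eq_mul]; ring
    _ ≤ ∑ j ∈ (ebhSelect α v).filter (· ∈ H0), α / p * v j := by
        -- For a selected `j` the cutoff `p / (α k̂) ≤ v j` rearranges to `1 / k̂ ≤ α / p * v j`.
        refine Finset.sum_le_sum fun j hj => ?_
        have h := (Finset.mem_filter.1 (Finset.mem_filter.1 hj).1).2.2
        rw [div_le_iff₀ (by positivity)] at h ⊢
        rw [div_mul_eq_mul_div, div_mul_eq_mul_div, le_div_iff₀ hp]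
        linarith
    _ ≤ ∑ j ∈ Finset.univ.filter (· ∈ H0), α / p * v j := by
        refine Finset.sum_le_sum_of_subset_of_nonneg (fun j hj => ?_) fun j _ _ =>
          mul_nonneg (by positivity) (hv j)
        exact Finset.mem_filter.2 ⟨Finset.mem_univ _, (Finset.mem_filter.1 hj).2⟩
    _ = _ := by rw [Finset.mul_sum]

/-! ### Measurability -/

section Measurability

variable {S : Type*} [MeasurableSpace S]

theorem measurable_card_filter {ι : Type*} [Fintype ι] {q : S → ι → Prop}
    [∀ s, DecidablePred (q s)] (h : ∀ i, MeasurableSet {s | q s i}) :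
    Measurable fun s => (Finset.univ.filter fun i => q s i).card := by
  classical
  simp_rw [Finset.card_filter]
  refine Finset.measurable_sum _ fun i _ => ?_
  have : (fun s => if q s i then (1 : ℕ) else 0) = ({s | q s i}).indicator fun _ => 1 := by
    ext s; simp [Set.indicator_apply]
  rw [this]
  exact measurable_const.indicator (h i)

theorem measurable_natCast_comp {f : S → ℕ} (hf : Measurable f) :
    Measurable fun s => (f s : ℝ) :=
  measurable_from_top.comp hf

theorem measurableSet_stopAt {p : ℕ} (α : ℝ) {w : S → Fin p → ℝ} (hw : Measurable w) {t : S → ℝ}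
    (ht : Measurable t) : MeasurableSet {s | StopAt α (w s) (t s)} := by
  have hwk : ∀ k, Measurable fun s => w s k := fun k => (measurable_pi_apply k).comp hw
  have h1 : Measurable fun s => ((Finset.univ.filter fun k => w s k ≤ -t s).card : ℝ) :=
    measurable_natCast_comp (measurable_card_filter fun k => measurableSet_le (hwk k) ht.neg)
  have h2 : Measurable fun s => ((Finset.univ.filter fun k => t s ≤ w s k).card : ℝ) :=
    measurable_natCast_comp (measurable_card_filter fun k => measurableSet_le ht (hwk k))
  exact (measurableSet_le ((measurable_const.add h1).div h2) measurable_const).union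
    (measurableSet_lt h2 measurable_const)

/-- By `threshold_le_iff` the event is a finite union of comparisons of real functions, so
measurability on `WithTop ℝ` never enters. -/
theorem measurableSet_threshold_le {p : ℕ} (α : ℝ) {w : S → Fin p → ℝ} (hw : Measurable w)
    {x : S → ℝ} (hx : Measurable x) :
    MeasurableSet {s | threshold α (w s) ≤ (x s : WithTop ℝ)} := by
  have hwk : ∀ k, Measurable fun s => |w s k| := fun k =>
    ((measurable_pi_apply k).comp hw).abs
  have : {s | threshold α (w s) ≤ (x s : WithTop ℝ)} =
      ⋃ k, {s | 0 < |w s k|} ∩ ({s | StopAt α (w s) |w s k|} ∩ {s | |w s k| ≤ x s}) := by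
    ext s
    simp [threshold_le_iff]
  rw [this]
  exact MeasurableSet.iUnion fun k => (measurableSet_lt measurable_const (hwk k)).inter
    ((measurableSet_stopAt α hw (hwk k)).inter (measurableSet_le (hwk k) hx))

theorem measurable_absUpdate {p : ℕ} {w : S → Fin p → ℝ} (hw : Measurable w) (j : Fin p) :
    Measurable fun s => absUpdate (w s) j := by
  refine measurable_pi_lambda _ fun k => ?_
  by_cases hk : k = j
  · subst hk
    simp only [absUpdate_self]
    exact ((measurable_pi_apply k).comp hw).abs
  · simp only [absUpdate_of_ne _ hk]
    exact (measurable_pi_apply k).comp hw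

theorem measurable_eValue {p : ℕ} (α : ℝ) {w : S → Fin p → ℝ} (hw : Measurable w) (j : Fin p) :
    Measurable fun s => eValue α (w s) j := by
  have hwk : ∀ k, Measurable fun s => w s k := fun k => (measurable_pi_apply k).comp hw
  unfold eValue
  refine (measurable_const.mul (Measurable.ite (measurableSet_threshold_le α hw (hwk j))
    measurable_const measurable_const)).div (measurable_const.add ?_)
  exact measurable_natCast_comp
    (measurable_card_filter fun k => measurableSet_threshold_le α hw (hwk k).neg)

theorem measurable_negWeight {p : ℕ} (α : ℝ) {w : S → Fin p → ℝ} (hw : Measurable w)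
    (j : Fin p) : Measurable fun s => negWeight α (w s) j := by
  have hwk : ∀ k, Measurable fun s => w s k := fun k => (measurable_pi_apply k).comp hw
  unfold negWeight looWeight
  refine Measurable.ite (measurableSet_threshold_le α (measurable_absUpdate hw j) (hwk j).neg)
    (measurable_const.add ?_).inv measurable_const
  refine measurable_natCast_comp (measurable_card_filter fun k => ?_)
  exact (MeasurableSet.const _).inter
    (measurableSet_threshold_le α (measurable_absUpdate hw j) (hwk k).neg)

theorem measurable_avgEValue {M p : ℕ} (α : ℝ) {W : Fin M → S → Fin p → ℝ}
    (hW : ∀ m, Measurable (W m)) (j : Fin p) :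
    Measurable fun s => avgEValue α (fun m => W m s) j := by
  unfold avgEValue
  exact measurable_const.mul
    (Finset.measurable_sum _ fun m _ => measurable_eValue α (hW m) j)

theorem measurable_kthLargest {n k : ℕ} (hk : 1 ≤ k) (hkn : k ≤ n) {a : S → Fin n → ℝ}
    (ha : ∀ i, Measurable fun s => a s i) : Measurable fun s => kthLargest (a s) k := by
  refine measurable_of_Ici fun x => ?_
  have : (fun s => kthLargest (a s) k) ⁻¹' Set.Ici x =
      (fun s => (Finset.univ.filter fun i => x ≤ a s i).card) ⁻¹' Set.Ici k := by
    ext s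
    simp [le_kthLargest_iff hk hkn]
  rw [this]
  exact measurable_card_filter (fun i => measurableSet_le measurable_const (ha i))
    measurableSet_Ici

theorem measurable_ebhCount {p : ℕ} (α : ℝ) {v : S → Fin p → ℝ}
    (hv : ∀ j, Measurable fun s => v s j) : Measurable fun s => ebhCount α (v s) := by
  classical
  have hset : ∀ k ∈ Finset.Icc 1 p,
      MeasurableSet {s | (p : ℝ) / (α * k) ≤ kthLargest (v s) k} := fun k hk =>
    measurableSet_le measurable_const
      (measurable_kthLargest (Finset.mem_Icc.1 hk).1 (Finset.mem_Icc.1 hk).2 hv)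
  -- The index set of the supremum depends on `s`; indicators replace it by a fixed one. Their value
  -- `0` off the event is the bottom of `ℕ` and does not affect the supremum.
  have heq : ∀ s, ebhCount α (v s) = (Finset.Icc 1 p).sup
      fun k => {s | (p : ℝ) / (α * k) ≤ kthLargest (v s) k}.indicator (fun _ => k) s := by
    intro s
    apply le_antisymm
    · refine Finset.sup_le fun k hk => ?_
      obtain ⟨hk1, hk2⟩ := Finset.mem_filter.1 hk
      refine Finset.le_sup_of_le hk1 ?_
      rw [Set.indicator_of_mem (by exact hk2)]
      rfl
    · refine Finset.sup_le fun k hk => ?_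
      by_cases h : (p : ℝ) / (α * k) ≤ kthLargest (v s) k
      · rw [Set.indicator_of_mem (by exact h)]
        exact Finset.le_sup (f := id) (Finset.mem_filter.2 ⟨hk, h⟩)
      · rw [Set.indicator_of_notMem (by exact h)]
        exact Nat.zero_le _
  simp_rw [heq]
  have hfun : ∀ T : Finset ℕ, T ⊆ Finset.Icc 1 p → Measurable fun s => T.sup
      fun k => {s | (p : ℝ) / (α * k) ≤ kthLargest (v s) k}.indicator (fun _ => k) s := by
    intro T
    induction T using Finset.induction_on with
    | empty => intro _; simp
    | insert a T _ ih =>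
      intro hT
      simp only [Finset.sup_insert]
      exact (measurable_const.indicator (hset a (hT (Finset.mem_insert_self _ _)))).sup
        (ih ((Finset.subset_insert _ _).trans hT))
  exact hfun _ le_rfl

theorem measurable_fdp {p : ℕ} (H0 : Set (Fin p)) {R : S → Finset (Fin p)}
    (hR : ∀ j, MeasurableSet {s | j ∈ R s}) : Measurable fun s => fdp H0 (R s) := by
  classical
  have h1 : Measurable fun s => (Finset.univ.filter fun j => j ∈ R s ∧ j ∈ H0).card :=
    measurable_card_filter fun j => (hR j).inter (MeasurableSet.const (j ∈ H0))
  have h2 : Measurable fun s => (Finset.univ.filter fun j => j ∈ R s).card :=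
    measurable_card_filter hR
  have heq : (fun s => fdp H0 (R s)) = fun s =>
      ((Finset.univ.filter fun j => j ∈ R s ∧ j ∈ H0).card : ℝ) /
        max ((Finset.univ.filter fun j => j ∈ R s).card : ℝ) 1 := by
    ext s
    rw [fdp, Finset.filter_univ_mem]
    congr 3
    ext j
    simp
  rw [heq]
  exact (measurable_natCast_comp h1).div ((measurable_natCast_comp h2).max measurable_const)

theorem measurableSet_mem_ebhSelect {p : ℕ} (α : ℝ) {v : S → Fin p → ℝ}
    (hv : ∀ j, Measurable fun s => v s j) (j : Fin p) :
    MeasurableSet {s | j ∈ ebhSelect α (v s)} := by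
  have heq : {s | j ∈ ebhSelect α (v s)} = {s | 0 < ebhCount α (v s)} ∩
      {s | (p : ℝ) / (α * (ebhCount α (v s) : ℝ)) ≤ v s j} := by
    ext s
    simp [ebhSelect]
  have hc := measurable_ebhCount α hv
  rw [heq]
  exact (measurableSet_lt measurable_const hc).inter (measurableSet_le
    (measurable_const.div (measurable_const.mul (measurable_natCast_comp hc))) (hv j))

end Measurability

/-! ### Expected e-values of one run and control of the false discovery rate -/

theorem integrable_eValue {S : Type*} [MeasurableSpace S] {ν : Measure S} [IsFiniteMeasure ν]
    {p : ℕ} (α : ℝ) {w : S → Fin p → ℝ} (hw : Measurable w) (j : Fin p) :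
    Integrable (fun s => eValue α (w s) j) ν := by
  refine Integrable.of_bound (measurable_eValue α hw j).aestronglyMeasurable (p : ℝ)
    (Filter.Eventually.of_forall fun s => ?_)
  rw [Real.norm_of_nonneg (eValue_nonneg _ _ _)]
  exact eValue_le _ _ _

theorem integrable_negWeight {S : Type*} [MeasurableSpace S] {ν : Measure S} [IsFiniteMeasure ν]
    {p : ℕ} (α : ℝ) {w : S → Fin p → ℝ} (hw : Measurable w) (j : Fin p) :
    Integrable (fun s => negWeight α (w s) j) ν := by
  refine Integrable.of_bound (measurable_negWeight α hw j).aestronglyMeasurable 1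
    (Filter.Eventually.of_forall fun s => ?_)
  rw [Real.norm_of_nonneg (negWeight_nonneg _ _ _)]
  exact (Finset.single_le_sum (fun k _ => negWeight_nonneg α (w s) k)
    (Finset.mem_univ j)).trans (sum_negWeight_le_one α (w s))

/-- If the sign of each null statistic can be reversed, whenever it is positive, by a measure
preserving map that does not affect the remaining statistics, then the null knockoff e-values
have total expectation at most `p`. -/
theorem sum_integral_eValue_le {S : Type*} [MeasurableSpace S] (ν : Measure S)
    [IsProbabilityMeasure ν] {p : ℕ} (α : ℝ) {w : S → Fin p → ℝ} (hw : Measurable w)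
    (H : Finset (Fin p))
    (hφ : ∀ j ∈ H, ∃ φ : S → S, MeasurePreserving φ ν ν ∧
      ∀ᵐ s ∂ν, 0 < w s j → w (φ s) = Function.update (w s) j (-w s j)) :
    ∑ j ∈ H, ∫ s, eValue α (w s) j ∂ν ≤ p := by
  have hle : ∀ j ∈ H, ∫ s, eValue α (w s) j ∂ν ≤ p * ∫ s, negWeight α (w s) j ∂ν := by
    intro j hj
    obtain ⟨φ, hφ, hflip⟩ := hφ j hj
    -- Change of variables along the measure preserving map `φ`.
    have hint : ∫ s, negWeight α (w s) j ∂ν = ∫ s, negWeight α (w (φ s)) j ∂ν := by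
      conv_lhs => rw [← hφ.map_eq]
      exact integral_map hφ.measurable.aemeasurable
        (measurable_negWeight α hw j).aestronglyMeasurable
    rw [hint, ← integral_const_mul]
    refine integral_mono_ae (integrable_eValue α hw j)
      ((integrable_negWeight α (hw.comp hφ.measurable) j).const_mul _) ?_
    filter_upwards [hflip] with s hs
    rcases lt_or_ge 0 (w s j) with h | h
    · rw [eValue_eq_negWeight h, ← hs h]
    -- Where `w s j ≤ 0` the e-value vanishes and the other side is nonnegative, so nothing about
    -- `φ` is needed there.
    · rw [eValue_eq_zero_of_nonpos h]
      exact mul_nonneg (by positivity) (negWeight_nonneg _ _ _)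
  calc ∑ j ∈ H, ∫ s, eValue α (w s) j ∂ν
      ≤ ∑ j ∈ H, p * ∫ s, negWeight α (w s) j ∂ν := Finset.sum_le_sum hle
    _ = p * ∫ s, ∑ j ∈ H, negWeight α (w s) j ∂ν := by
        rw [integral_finsetSum _ fun j _ => integrable_negWeight α hw j, Finset.mul_sum]
    _ ≤ p * ∫ _s, 1 ∂ν := by
        refine mul_le_mul_of_nonneg_left (integral_mono_ae
          (integrable_finsetSum _ fun j _ => integrable_negWeight α hw j)
          (integrable_const _) (Filter.Eventually.of_forall fun s => ?_)) (by positivity)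
        exact (Finset.sum_le_sum_of_subset_of_nonneg (Finset.subset_univ H)
          fun j _ _ => negWeight_nonneg _ _ _).trans (sum_negWeight_le_one α (w s))
    _ = p := by simp

open Classical in
/-- The derandomized filter controls the false discovery rate if, in each run, the null knockoff
e-values have total expectation at most `p`. -/
theorem controlsFDR_derandSelect {Ω : Type*} [MeasurableSpace Ω] (μ : Measure Ω)
    [IsProbabilityMeasure μ] {M p : ℕ} (hM : 1 ≤ M) {αkn αebh : ℝ} (hebh : 0 < αebh)
    (H0 : Set (Fin p)) {V : Fin M → Ω → Fin p → ℝ} (hV : ∀ m, Measurable (V m))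
    (hE : ∀ m, ∑ j ∈ Finset.univ.filter (· ∈ H0), ∫ ω, eValue αkn (V m ω) j ∂μ ≤ p) :
    ControlsFDR μ H0 (fun ω => derandSelect αkn αebh fun m => V m ω) αebh := by
  have hmeas : Measurable fun ω => fdp H0 (derandSelect αkn αebh fun m => V m ω) :=
    measurable_fdp H0 fun j => measurableSet_mem_ebhSelect αebh
      (fun j => measurable_avgEValue αkn hV j) j
  have hint : Integrable (fun ω => fdp H0 (derandSelect αkn αebh fun m => V m ω)) μ := by
    refine Integrable.of_bound hmeas.aestronglyMeasurable 1 (Filter.Eventually.of_forall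
      fun ω => ?_)
    rw [Real.norm_of_nonneg (fdp_nonneg _ _)]
    exact fdp_le_one _ _
  refine ⟨hint, ?_⟩
  have havg : ∀ j, Integrable (fun ω => avgEValue αkn (fun m => V m ω) j) μ := fun j =>
    (integrable_finsetSum _ fun m _ => integrable_eValue αkn (hV m) j).const_mul _
  have hM' : (0 : ℝ) < M := by exact_mod_cast hM
  have hsum : ∑ j ∈ Finset.univ.filter (· ∈ H0), ∫ ω, avgEValue αkn (fun m => V m ω) j ∂μ ≤ p := by
    have h1 : ∀ j, ∫ ω, avgEValue αkn (fun m => V m ω) j ∂μ =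
        (1 / M : ℝ) * ∑ m, ∫ ω, eValue αkn (V m ω) j ∂μ := fun j => by
      unfold avgEValue
      rw [integral_const_mul, integral_finsetSum _ fun m _ => integrable_eValue αkn (hV m) j]
    simp_rw [h1]
    rw [← Finset.mul_sum, Finset.sum_comm]
    calc (1 / M : ℝ) * ∑ m, ∑ j ∈ Finset.univ.filter (· ∈ H0), ∫ ω, eValue αkn (V m ω) j ∂μ
        ≤ (1 / M : ℝ) * ∑ _m : Fin M, (p : ℝ) :=
          mul_le_mul_of_nonneg_left (Finset.sum_le_sum fun m _ => hE m) (by positivity)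
      _ = p := by
          rw [Finset.sum_const, Finset.card_univ, Fintype.card_fin, nsmul_eq_mul]
          field_simp
  calc ∫ ω, fdp H0 (derandSelect αkn αebh fun m => V m ω) ∂μ
      ≤ ∫ ω, αebh / p * ∑ j ∈ Finset.univ.filter (· ∈ H0),
          avgEValue αkn (fun m => V m ω) j ∂μ := by
        refine integral_mono hint
          ((integrable_finsetSum _ fun j _ => havg j).const_mul _) fun ω => ?_
        exact fdp_ebhSelect_le hebh H0 fun j => mul_nonneg (by positivity)
          (Finset.sum_nonneg fun m _ => eValue_nonneg _ _ _)
    _ = αebh / p * ∑ j ∈ Finset.univ.filter (· ∈ H0),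
          ∫ ω, avgEValue αkn (fun m => V m ω) j ∂μ := by
        rw [integral_const_mul, integral_finsetSum _ fun j _ => havg j]
    _ ≤ αebh / p * p := mul_le_mul_of_nonneg_left hsum (by positivity)
    _ ≤ αebh := by
        -- For `p = 0` division by zero makes the left side `0`.
        rcases eq_or_ne (p : ℝ) 0 with h | h
        · simpa [h] using hebh.le
        · rw [div_mul_cancel₀ _ h]

/-! ### Sign flips of the statistics -/

/-- Change the signs of the entries of `w` in column `j` and rows `A`. -/
def flipCol {E p : ℕ} (A : Finset (Fin E)) (j : Fin p) (w : Fin E → Fin p → ℝ) :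
    Fin E → Fin p → ℝ :=
  fun e k => if e ∈ A ∧ k = j then -w e k else w e k

theorem measurable_flipCol {E p : ℕ} (A : Finset (Fin E)) (j : Fin p) :
    Measurable (flipCol A j) := by
  unfold flipCol
  refine measurable_pi_lambda _ fun e => measurable_pi_lambda _ fun k => ?_
  split_ifs <;> fun_prop

theorem flipCol_insert {E p : ℕ} {A : Finset (Fin E)} {e : Fin E} (he : e ∉ A) (j : Fin p)
    (w : Fin E → Fin p → ℝ) : flipCol (insert e A) j w = flipCol {e} j (flipCol A j w) := by
  ext e' k
  simp only [flipCol, Finset.mem_insert, Finset.mem_singleton]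
  by_cases h : e' = e
  · subst h; simp [he]
  · simp [h]

theorem flipCol_of_ne {E p : ℕ} (A : Finset (Fin E)) {j k : Fin p} (h : k ≠ j)
    (w : Fin E → Fin p → ℝ) (e : Fin E) : flipCol A j w e k = w e k := by
  simp [flipCol, h]

theorem flipCol_self {E p : ℕ} (A : Finset (Fin E)) (j : Fin p)
    (w : Fin E → Fin p → ℝ) (e : Fin E) :
    flipCol A j w e j = if e ∈ A then -w e j else w e j := by
  simp [flipCol]

theorem abs_flipCol {E p : ℕ} (A : Finset (Fin E)) (j : Fin p)
    (w : Fin E → Fin p → ℝ) (e : Fin E) (k : Fin p) : |flipCol A j w e k| = |w e k| := by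
  simp only [flipCol]
  split_ifs <;> simp

/-- The law `Q` of a random matrix is invariant under changing the sign of any entry for which the
conditional independence null is true. -/
def FlipInvariant {E p : ℕ} (P : Fin E → Measure ((Fin p → ℝ) × ℝ))
    [∀ e, IsFiniteMeasure (P e)] (Q : Measure (Fin E → Fin p → ℝ)) : Prop :=
  ∀ e j, CINull (P e) j → Q.map (flipCol {e} j) = Q

/-- Flips of distinct rows compose, so invariance passes from single entries to sets of null rows.
-/
theorem FlipInvariant.map_flipCol {E p : ℕ} {P : Fin E → Measure ((Fin p → ℝ) × ℝ)}
    [∀ e, IsFiniteMeasure (P e)] {Q : Measure (Fin E → Fin p → ℝ)} (hQ : FlipInvariant P Q)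
    (j : Fin p) (A : Finset (Fin E)) (hA : ∀ e ∈ A, CINull (P e) j) :
    Q.map (flipCol A j) = Q := by
  induction A using Finset.induction_on with
  | empty =>
    have : (flipCol ∅ j : (Fin E → Fin p → ℝ) → _) = id := by
      ext w e k; simp [flipCol]
    rw [this, Measure.map_id]
  | insert e A he ih =>
    have : (flipCol (insert e A) j : (Fin E → Fin p → ℝ) → _) = flipCol {e} j ∘ flipCol A j :=
      funext fun w => flipCol_insert he j w
    rw [this, ← Measure.map_map (measurable_flipCol _ _) (measurable_flipCol _ _),
      ih fun e' he' => hA e' (Finset.mem_insert_of_mem he'),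
      hQ e j (hA e (Finset.mem_insert_self _ _))]

/-! ### Valid statistics -/

instance : IsProbabilityMeasure fairSign := by
  constructor
  simp [fairSign, ENNReal.inv_two_add_inv_two]

theorem fairSign_map_neg : fairSign.map (fun x => -x) = fairSign := by
  unfold fairSign
  rw [Measure.map_add _ _ measurable_neg, Measure.map_smul, Measure.map_smul,
    Measure.map_dirac' measurable_neg, Measure.map_dirac' measurable_neg, neg_neg, add_comm]

/-- The law is a product and only the coordinate `(e, j)` is negated; under the null that coordinate
is a fair sign. -/
theorem signMatrixLaw_map_flipCol {E p : ℕ} (P : Fin E → Measure ((Fin p → ℝ) × ℝ))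
    [∀ e, IsFiniteMeasure (P e)] {e : Fin E} {j : Fin p} (h : CINull (P e) j) :
    (signMatrixLaw P).map (flipCol {e} j) = signMatrixLaw P := by
  classical
  unfold signMatrixLaw
  have hprob : ∀ e' k, IsProbabilityMeasure
      (if CINull (P e') k then fairSign else Measure.dirac 1) := fun e' k => by
    split_ifs <;> infer_instance
  let g : Fin E → Fin p → ℝ → ℝ := fun e' k x => if e' = e ∧ k = j then -x else x
  have hg : ∀ e' k, Measurable (g e' k) := fun e' k => by
    simp only [g]; split_ifs <;> fun_prop
  have hmap : ∀ e' k, (if CINull (P e') k then fairSign else Measure.dirac 1).map (g e' k) =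
      if CINull (P e') k then fairSign else Measure.dirac 1 := by
    intro e' k
    by_cases hek : e' = e ∧ k = j
    · obtain ⟨rfl, rfl⟩ := hek
      simp only [g, and_self, if_true, h]
      exact fairSign_map_neg
    · have : g e' k = id := by ext x; simp [g, hek]
      rw [this, Measure.map_id]
  have hrow : ∀ e', (Measure.pi fun k =>
      if CINull (P e') k then fairSign else Measure.dirac 1).map (fun x k => g e' k (x k)) =
      Measure.pi fun k => if CINull (P e') k then fairSign else Measure.dirac 1 := by
    intro e'
    have : ∀ k, IsProbabilityMeasure ((if CINull (P e') k then fairSign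
        else Measure.dirac 1).map (g e' k)) := fun k => by rw [hmap]; exact hprob e' k
    rw [Measure.pi_map_pi fun k => (hg e' k).aemeasurable]
    simp_rw [hmap]
  have hflip : (flipCol {e} j : (Fin E → Fin p → ℝ) → _) =
      fun w e' => (fun x k => g e' k (x k)) (w e') := by
    ext w e' k
    simp [flipCol, g]
  have : ∀ e', IsProbabilityMeasure ((Measure.pi fun k =>
      if CINull (P e') k then fairSign else Measure.dirac 1).map (fun x k => g e' k (x k))) :=
    fun e' => by rw [hrow]; infer_instance
  have hgm : ∀ e', Measurable fun (x : Fin p → ℝ) k => g e' k (x k) := fun e' =>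
    measurable_pi_lambda _ fun k => (hg e' k).comp (measurable_pi_apply k)
  rw [hflip, Measure.pi_map_pi (f := fun e' (x : Fin p → ℝ) k => g e' k (x k))
    fun e' => (hgm e').aemeasurable]
  simp_rw [hrow]

instance {E p : ℕ} (P : Fin E → Measure ((Fin p → ℝ) × ℝ)) [∀ e, IsFiniteMeasure (P e)] :
    IsProbabilityMeasure (signMatrixLaw P) := by
  unfold signMatrixLaw
  have hprob : ∀ e' k, IsProbabilityMeasure (open Classical in
      (if CINull (P e') k then fairSign else Measure.dirac 1)) := fun e' k => by
    split_ifs <;> infer_instance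
  infer_instance

/-- Flipping an entry of `w ⊙ ε` is the same as flipping it in `ε`, whose law is invariant and which
is independent of `w`. -/
theorem IsValidStat.flipInvariant {Ω : Type*} [MeasurableSpace Ω] {μ : Measure Ω}
    [IsProbabilityMeasure μ] {E p : ℕ} {P : Fin E → Measure ((Fin p → ℝ) × ℝ)}
    [∀ e, IsFiniteMeasure (P e)] {w : Ω → Fin E → Fin p → ℝ} (hw : Measurable w)
    (h : IsValidStat μ P w) : FlipInvariant P (μ.map w) := by
  intro e j hej
  have : IsProbabilityMeasure (μ.map w) := Measure.isProbabilityMeasure_map hw.aemeasurable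
  have hmul : Measurable fun q : (Fin E → Fin p → ℝ) × (Fin E → Fin p → ℝ) => q.1 * q.2 := by
    refine measurable_pi_lambda _ fun e => measurable_pi_lambda _ fun k => ?_
    simp only [Pi.mul_apply]
    fun_prop
  unfold IsValidStat at h
  have hcomp : (flipCol {e} j) ∘ (fun q : (Fin E → Fin p → ℝ) × (Fin E → Fin p → ℝ) =>
      q.1 * q.2) = (fun q => q.1 * q.2) ∘ Prod.map id (flipCol {e} j) := by
    ext q e' k
    simp only [Function.comp, flipCol, Prod.map, Pi.mul_apply, id]
    split_ifs <;> simp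
  conv_lhs => rw [← h]
  rw [Measure.map_map (measurable_flipCol _ _) hmul, hcomp,
    ← Measure.map_map hmul (measurable_id.prodMap (measurable_flipCol _ _)),
    ← Measure.map_prod_map _ _ measurable_id (measurable_flipCol _ _), Measure.map_id,
    signMatrixLaw_map_flipCol P hej, h]

/-! ### Exchangeability of knockoffs for the nulls -/

theorem measurable_swapCol {n p : ℕ} (j : Fin p) :
    Measurable (swapCol j : CovMat n p × CovMat n p → _) := by
  unfold swapCol
  refine Measurable.prodMk ?_ ?_ <;>
  · refine measurable_pi_lambda _ fun i => measurable_pi_lambda _ fun k => ?_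
    split_ifs <;> fun_prop

theorem measurable_swap {n p : ℕ} (j : Fin p) :
    Measurable (AugData.swap j : AugData n p → AugData n p) := by
  have h : Measurable fun d : AugData n p => swapCol j (d.1.cov, d.2) :=
    (measurable_swapCol j).comp ((measurable_cov.comp measurable_fst).prodMk measurable_snd)
  unfold AugData.swap
  refine Measurable.prodMk (measurable_pi_lambda _ fun i => Measurable.prodMk ?_ ?_) h.snd
  · exact (measurable_pi_apply i).comp h.fst
  · fun_prop

/-- Composition with a kernel that is represented by a function of uniform noise. -/
theorem compProd_eq_map_prod {X Y N : Type*} [MeasurableSpace X] [MeasurableSpace Y]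
    [MeasurableSpace N] (Q : Measure X) [SFinite Q] (ν : Measure N) [SFinite ν]
    (κ : Kernel X Y) [IsSFiniteKernel κ] {f : X → N → Y} (hf : Measurable (Function.uncurry f))
    (hκ : ∀ x, ν.map (f x) = κ x) :
    Q ⊗ₘ κ = (Q.prod ν).map fun q => (q.1, f q.1 q.2) := by
  have hm : Measurable fun q : X × N => (q.1, f q.1 q.2) := measurable_fst.prodMk hf
  ext s hs
  rw [Measure.compProd_apply hs, Measure.map_apply hm hs, Measure.prod_apply (hm hs)]
  refine lintegral_congr fun x => ?_
  rw [← hκ x, Measure.map_apply hf.of_uncurry_left (measurable_prodMk_left hs)]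
  rfl

/-- Under the conditional independence null, the response is a function of the remaining features
and independent uniform noise. -/
theorem CINull.exists_response {p : ℕ} {P : Measure ((Fin p → ℝ) × ℝ)} [IsProbabilityMeasure P]
    {j : Fin p} (h : CINull P j) :
    ∃ f : ({k : Fin p // k ≠ j} → ℝ) → unitInterval → ℝ, Measurable (Function.uncurry f) ∧
      (P.fst.prod volume).map (fun q => (q.1, f (fun k => q.1 k) q.2)) = P := by
  have hk : Measurable fun (z : (Fin p → ℝ) × ℝ) (k : {k : Fin p // k ≠ j}) => z.1 k := by
    fun_prop
  have hj : Measurable fun z : (Fin p → ℝ) × ℝ => z.1 j := by fun_prop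
  -- Conditional independence says that the law of `Y` given `(X_{-j}, X_j)` is a kernel in `X_{-j}`
  -- alone.
  have h1 := (condIndepFun_iff_condDistrib_prod_ae_eq_prodMkRight measurable_snd hj hk).1 h.symm
  rw [condDistrib_ae_eq_iff_measure_eq_compProd _ measurable_snd.aemeasurable] at h1
  set κ := condDistrib (fun z : (Fin p → ℝ) × ℝ => z.2)
    (fun (z : (Fin p → ℝ) × ℝ) (k : {k : Fin p // k ≠ j}) => z.1 k) P
  obtain ⟨f, hf, hfκ⟩ := Kernel.exists_measurable_map_eq_unitInterval κ
  refine ⟨f, hf, ?_⟩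
  let g : (Fin p → ℝ) × ℝ → ({k : Fin p // k ≠ j} → ℝ) × ℝ := fun z => (fun k => z.1 k, z.1 j)
  have hg : Measurable g := hk.prodMk hj
  have hf' : Measurable (Function.uncurry
      fun (x : ({k : Fin p // k ≠ j} → ℝ) × ℝ) (u : unitInterval) => f x.1 u) :=
    hf.comp ((measurable_fst.comp measurable_fst).prodMk measurable_snd)
  have hprob : IsProbabilityMeasure (P.map g) := Measure.isProbabilityMeasure_map hg.aemeasurable
  rw [compProd_eq_map_prod (P.map g) volume _ hf' fun x => by
    rw [Kernel.prodMkRight_apply]; exact hfκ x.1] at h1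
  -- `glue` reassembles `X` from `g (X, Y) = (X_{-j}, X_j)`, turning `h1` into an identity for the
  -- law of `(X, Y)`.
  let glue : ({k : Fin p // k ≠ j} → ℝ) × ℝ → Fin p → ℝ := fun a k =>
    if hk : k = j then a.2 else a.1 ⟨k, hk⟩
  have hglue : Measurable glue := by
    refine measurable_pi_lambda _ fun k => ?_
    by_cases hk : k = j
    · simp only [glue, hk, dite_true]; fun_prop
    · simp only [glue, hk, dite_false]; fun_prop
  have hgg : ∀ z, glue (g z) = z.1 := by
    intro z
    ext k
    by_cases hk : k = j
    · simp [glue, g, hk]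
    · simp [glue, g, hk]
  have hfk : Measurable fun q : (Fin p → ℝ) × unitInterval => f (fun k => q.1 k) q.2 :=
    hf.comp (Measurable.prodMk (by fun_prop) measurable_snd)
  have hfg : Measurable fun q : (({k : Fin p // k ≠ j} → ℝ) × ℝ) × unitInterval =>
    (q.1, f q.1.1 q.2) := measurable_fst.prodMk hf'
  have h2 := congrArg (Measure.map (Prod.map glue id)) h1
  rw [Measure.map_map (hglue.prodMap measurable_id) (hg.prodMk measurable_snd),
    Measure.map_map (hglue.prodMap measurable_id) hfg] at h2
  have hid : (Prod.map glue id ∘ fun z : (Fin p → ℝ) × ℝ => (g z, z.2)) = id := by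
    ext1 z
    simp [hgg]
  have hprod : (P.map g).prod (volume : Measure unitInterval) =
      (P.prod volume).map (Prod.map g id) := by
    rw [← Measure.map_prod_map _ _ hg measurable_id, Measure.map_id]
  have hprod' : P.fst.prod (volume : Measure unitInterval) =
      (P.prod volume).map (Prod.map Prod.fst id) := by
    rw [← Measure.map_prod_map _ _ measurable_fst measurable_id, Measure.map_id]
    rfl
  rw [hid, Measure.map_id] at h2
  rw [hprod, Measure.map_map ((hglue.prodMap measurable_id).comp hfg)
    (hg.prodMap measurable_id)] at h2
  rw [hprod', Measure.map_map (measurable_fst.prodMk hfk) (measurable_fst.prodMap measurable_id)]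
  conv_rhs => rw [h2]
  congr 1
  ext1 q
  simp only [Function.comp, Prod.map, id, hgg]
  rfl

/-- If the rows of the data are functions of the covariates and independent noise, the law of the
data and knockoffs is obtained from the law of the covariates and knockoffs by adding noise. -/
theorem augLaw_eq_map {p n : ℕ} {P : Measure ((Fin p → ℝ) × ℝ)} [IsProbabilityMeasure P]
    (K : Kernel (CovMat n p) (CovMat n p)) [IsMarkovKernel K]
    {h : (Fin p → ℝ) × unitInterval → ℝ} (hh : Measurable h)
    (hP : (P.fst.prod volume).map (fun q => (q.1, h q)) = P) :
    augLaw n P K = (((Measure.pi fun _ : Fin n => P.fst) ⊗ₘ K).prod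
        (Measure.pi fun _ : Fin n => (volume : Measure unitInterval))).map
      fun q : (CovMat n p × CovMat n p) × (Fin n → unitInterval) =>
        (fun i => (q.1.1 i, h (q.1.1 i, q.2 i)), q.1.2) := by
  set Q := Measure.pi fun _ : Fin n => P.fst with hQ
  set V := Measure.pi fun _ : Fin n => (volume : Measure unitInterval) with hV
  let H : CovMat n p × (Fin n → unitInterval) → EnvData n p :=
    fun q i => (q.1 i, h (q.1 i, q.2 i))
  have hrow : ∀ i : Fin n, Measurable fun q : CovMat n p × (Fin n → unitInterval) => q.1 i :=
    fun i => (measurable_pi_apply i).comp measurable_fst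
  have hH : Measurable H := measurable_pi_lambda _ fun i =>
    (hrow i).prodMk (hh.comp ((hrow i).prodMk ((measurable_pi_apply i).comp measurable_snd)))
  have hpi : (Measure.pi fun _ : Fin n => P) = (Q.prod V).map H := by
    have hm : Measurable fun q : (Fin p → ℝ) × unitInterval => (q.1, h q) :=
      measurable_fst.prodMk hh
    have hprob : IsProbabilityMeasure ((P.fst.prod (volume : Measure unitInterval)).map
        fun q => (q.1, h q)) := by rw [hP]; infer_instance
    have h1 := Measure.pi_map_pi (ι := Fin n)
      (μ := fun _ => P.fst.prod (volume : Measure unitInterval))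
      (f := fun _ q => (q.1, h q)) fun _ => hm.aemeasurable
    have h2 := (measurePreserving_arrowProdEquivProdArrow (Fin p → ℝ) unitInterval (Fin n)
      (fun _ => P.fst) fun _ => (volume : Measure unitInterval))
    rw [hP] at h1
    rw [← h1, ← h2.map_eq, Measure.map_map hH h2.measurable]
    rfl
  have hG : Measurable fun q : (CovMat n p × CovMat n p) × (Fin n → unitInterval) =>
      (H (q.1.1, q.2), q.1.2) :=
    (hH.comp ((measurable_fst.comp measurable_fst).prodMk measurable_snd)).prodMk
      (measurable_snd.comp measurable_fst)
  change _ = ((Q ⊗ₘ K).prod V).map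
    fun q : (CovMat n p × CovMat n p) × (Fin n → unitInterval) => (H (q.1.1, q.2), q.1.2)
  ext s hs
  have hs' := hG hs
  have hm : Measurable fun z : CovMat n p × (Fin n → unitInterval) =>
      (K.comap EnvData.cov measurable_cov) (H z) (Prod.mk (H z) ⁻¹' s) :=
    (Kernel.measurable_kernel_prodMk_left hs).comp hH
  rw [augLaw, hpi, Measure.compProd_apply hs,
    lintegral_map (Kernel.measurable_kernel_prodMk_left hs) hH, lintegral_prod _ hm.aemeasurable,
    Measure.map_apply hG hs, Measure.prod_apply hs',
    Measure.lintegral_compProd (measurable_measure_prodMk_left hs')]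
  refine lintegral_congr fun x => ?_
  have hsx : MeasurableSet {q : (Fin n → unitInterval) × CovMat n p | (H (x, q.1), q.2) ∈ s} :=
    ((hH.comp (measurable_const.prodMk measurable_fst)).prodMk measurable_snd) hs
  -- Given the covariates `x`, noise and knockoffs are independent with laws `V` and `K x`; the two
  -- sides integrate over them in opposite orders.
  exact (Measure.prod_apply (μ := V) (ν := K x) hsx).symm.trans (Measure.prod_apply_symm hsx)

/-- If the conditional independence null holds for the feature `j`, exchanging the `j`-th columns
of covariates and knockoffs does not change the law of data and knockoffs. -/
theorem CINull.augLaw_map_swap {p n : ℕ} {P : Measure ((Fin p → ℝ) × ℝ)}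
    [IsProbabilityMeasure P] {j : Fin p} (h : CINull P j)
    (K : Kernel (CovMat n p) (CovMat n p)) [IsMarkovKernel K]
    (hK : IsKnockoffKernel (Measure.pi fun _ : Fin n => P.fst) K) :
    (augLaw n P K).map (AugData.swap j) = augLaw n P K := by
  obtain ⟨f, hf, hP⟩ := h.exists_response
  have hh : Measurable fun q : (Fin p → ℝ) × unitInterval =>
      f (fun k : {k : Fin p // k ≠ j} => q.1 k) q.2 :=
    hf.comp (Measurable.prodMk (by fun_prop) measurable_snd)
  rw [augLaw_eq_map K hh hP]
  set Q := (Measure.pi fun _ : Fin n => P.fst) ⊗ₘ K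
  set V := Measure.pi fun _ : Fin n => (volume : Measure unitInterval)
  have hrow : ∀ i : Fin n, Measurable
      fun q : (CovMat n p × CovMat n p) × (Fin n → unitInterval) => q.1.1 i := fun i =>
    (measurable_pi_apply i).comp (measurable_fst.comp measurable_fst)
  have hG : Measurable fun q : (CovMat n p × CovMat n p) × (Fin n → unitInterval) =>
      ((fun i => (q.1.1 i, f (fun k : {k : Fin p // k ≠ j} => q.1.1 i k) (q.2 i)), q.1.2) :
        AugData n p) :=
    (measurable_pi_lambda _ fun i => (hrow i).prodMk (hh.comp
      ((hrow i).prodMk ((measurable_pi_apply i).comp measurable_snd)))).prodMk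
      (measurable_snd.comp measurable_fst)
  have hQV : (Q.prod V).map (Prod.map (swapCol j) id) = Q.prod V := by
    rw [← Measure.map_prod_map _ _ (measurable_swapCol j) measurable_id, Measure.map_id]
    congr 1
    exact hK j
  rw [Measure.map_map (measurable_swap j) hG]
  conv_rhs => rw [← hQV, Measure.map_map hG ((measurable_swapCol j).prodMap measurable_id)]
  congr 1
  ext1 q
  -- The response reads only the columns other than `j`, so generating it commutes with the swap.
  have hk : ∀ k : {k : Fin p // k ≠ j}, ∀ i, q.1.1 i k = (swapCol j q.1).1 i k := fun k i => by
    simp [swapCol, k.2]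
  simp only [Function.comp, Prod.map, id, AugData.swap]
  refine Prod.ext (funext fun i => Prod.ext rfl ?_) rfl
  simp only [hk]

/-- A statistic with the flip-sign property has a flip invariant law. -/
theorem FlipSign.flipInvariant {E p : ℕ} {n : Fin E → ℕ}
    {P : Fin E → Measure ((Fin p → ℝ) × ℝ)} [∀ e, IsProbabilityMeasure (P e)]
    (K : ∀ e, Kernel (CovMat (n e) p) (CovMat (n e) p)) [∀ e, IsMarkovKernel (K e)]
    (hK : ∀ e, IsKnockoffKernel (Measure.pi fun _ : Fin (n e) => (P e).fst) (K e))
    {F : (∀ e, AugData (n e) p) → Fin E → Fin p → ℝ} (hF : Measurable F) (hflip : FlipSign F) :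
    FlipInvariant P ((Measure.pi fun e => augLaw (n e) (P e) (K e)).map F) := by
  intro e j hej
  -- The swap acts in environment `e` only; since the environments are independent, invariance of
  -- that one factor suffices.
  let g : ∀ e', AugData (n e') p → AugData (n e') p := fun e' =>
    if e' = e then AugData.swap j else id
  have hg : ∀ e', Measurable (g e') := fun e' => by
    simp only [g]
    split_ifs
    · exact measurable_swap j
    · exact measurable_id
  have hgm : ∀ e', (augLaw (n e') (P e') (K e')).map (g e') = augLaw (n e') (P e') (K e') := by
    intro e'
    by_cases he : e' = e
    · subst he
      simp only [g, if_true]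
      exact hej.augLaw_map_swap (K e') (hK e')
    · simp only [g, he, if_false, Measure.map_id]
  have hprob : ∀ e', IsProbabilityMeasure (augLaw (n e') (P e') (K e')) := fun e' => by
    unfold augLaw; infer_instance
  have hprob' : ∀ e', IsProbabilityMeasure ((augLaw (n e') (P e') (K e')).map (g e')) :=
    fun e' => by rw [hgm]; exact hprob e'
  have hpi := Measure.pi_map_pi (μ := fun e' => augLaw (n e') (P e') (K e')) (f := g)
    fun e' => (hg e').aemeasurable
  simp_rw [hgm] at hpi
  have hgpi : Measurable fun (d : ∀ e, AugData (n e) p) e' => g e' (d e') :=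
    measurable_pi_lambda _ fun e' => (hg e').comp (measurable_pi_apply e')
  have hcomp : flipCol {e} j ∘ F = F ∘ fun (d : ∀ e, AugData (n e) p) e' => g e' (d e') := by
    ext d e' k
    have hupd : (fun e' => g e' (d e')) = Function.update d e ((d e).swap j) := by
      ext1 e'
      by_cases he : e' = e
      · subst he; simp [g]
      · simp [g, he]
    simp only [Function.comp, hupd, hflip d e j e' k, flipCol, Finset.mem_singleton]
  rw [Measure.map_map (measurable_flipCol _ _) hF, hcomp, ← Measure.map_map hF hgpi, hpi]

/-! ### The consistent nulls -/

theorem measurable_sign_cast : Measurable fun x : ℝ => ((SignType.sign x : SignType) : ℝ) := by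
  have : (fun x : ℝ => ((SignType.sign x : SignType) : ℝ)) =
      fun x => if 0 < x then 1 else if x < 0 then -1 else 0 := by
    ext x
    rw [sign_apply]
    split_ifs <;> simp
  rw [this]
  exact Measurable.ite measurableSet_Ioi measurable_const
    (Measurable.ite measurableSet_Iio measurable_const measurable_const)

theorem signType_cast_inf (a b : SignType) : ((a ⊓ b : SignType) : ℝ) = min (a : ℝ) (b : ℝ) := by
  rcases le_total a b with h | h
  · rw [inf_eq_left.2 h]
    revert h
    cases a <;> cases b <;> intro h <;> first | exact absurd h (by decide) | norm_num
  · rw [inf_eq_right.2 h]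
    revert h
    cases a <;> cases b <;> intro h <;> first | exact absurd h (by decide) | norm_num

theorem measurable_cstStat {E p : ℕ} :
    Measurable (cstStat : (Fin E → Fin p → ℝ) → Fin p → ℝ) := by
  have hent : ∀ e j, Measurable fun w : Fin E → Fin p → ℝ => w e j := fun e j =>
    (measurable_pi_apply j).comp (measurable_pi_apply e)
  refine measurable_pi_lambda _ fun j => ?_
  unfold cstStat
  refine Measurable.mul ?_ (Finset.measurable_prod _ fun e _ => (hent e j).abs)
  induction (Finset.univ : Finset (Fin E)) using Finset.induction_on with
  | empty => simp
  | insert a T _ ih =>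
    simp only [Finset.inf_insert, signType_cast_inf]
    exact (measurable_sign_cast.comp (hent a j)).min ih

/-- A positive statistic forces every entry of the column to be positive, so one flip, in any row,
makes the minimal sign `-1` and keeps the magnitudes. From a negative statistic this can fail, as
other entries may be negative. -/
theorem cstStat_flipCol {E p : ℕ} {w : Fin E → Fin p → ℝ} {j : Fin p} (e : Fin E)
    (h : 0 < cstStat w j) :
    cstStat (flipCol {e} j w) = Function.update (cstStat w) j (-cstStat w j) := by
  ext k
  by_cases hk : k = j
  · subst hk
    rw [Function.update_self]
    have hprod : 0 ≤ ∏ e, |w e k| := Finset.prod_nonneg fun _ _ => abs_nonneg _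
    have hinf : (Finset.univ.inf fun e => SignType.sign (w e k)) = 1 := by
      unfold cstStat at h
      generalize (Finset.univ.inf fun e => SignType.sign (w e k)) = x at h
      cases x
      · simp at h
      · simp only [SignType.neg_eq_neg_one, SignType.coe_neg_one] at h
        linarith
      · rfl
    have he : 0 < w e k := by
      have : (1 : SignType) ≤ SignType.sign (w e k) := by
        rw [← hinf]; exact Finset.inf_le (Finset.mem_univ e)
      exact sign_eq_one_iff.1 (le_antisymm (SignType.le_one _) this)
    have hinf' : (Finset.univ.inf fun e' => SignType.sign (flipCol {e} k w e' k)) = -1 := by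
      refine le_antisymm ?_ (SignType.neg_one_le _)
      refine (Finset.inf_le (Finset.mem_univ e)).trans ?_
      simp [flipCol_self, he]
    unfold cstStat
    rw [hinf, hinf']
    simp [abs_flipCol]
  · rw [Function.update_of_ne hk]
    unfold cstStat
    simp only [flipCol_of_ne _ hk]

/-! ### The partial consistency nulls -/

/-- The randomized binomial `p`-value with `m` trials, `i` successes and auxiliary variable `u`. -/
def binomPValue (m i : ℕ) (u : ℝ) : ℝ := ∑ l ∈ Finset.range i, binomMass l m + u * binomMass i m

theorem binomMass_nonneg (i m : ℕ) : 0 ≤ binomMass i m := by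
  unfold binomMass; positivity

theorem sum_binomMass (m : ℕ) : ∑ i ∈ Finset.range (m + 1), binomMass i m = 1 := by
  unfold binomMass
  rw [← Finset.sum_mul, ← Nat.cast_sum, Nat.sum_range_choose]
  push_cast
  rw [← mul_pow]
  norm_num

/-- For `u` in `[0, 1]` the value interpolates between consecutive values of the distribution
function, and these intervals are ordered in `i`. -/
theorem binomPValue_mono (m : ℕ) {i i' : ℕ} (h : i ≤ i') {u : ℝ} (h0 : 0 ≤ u) (h1 : u ≤ 1) :
    binomPValue m i u ≤ binomPValue m i' u := by
  rcases h.eq_or_lt with rfl | hlt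
  · exact le_rfl
  unfold binomPValue
  calc ∑ l ∈ Finset.range i, binomMass l m + u * binomMass i m
      ≤ ∑ l ∈ Finset.range i, binomMass l m + binomMass i m := by
        have := mul_le_of_le_one_left (binomMass_nonneg i m) h1
        linarith
    _ = ∑ l ∈ Finset.range (i + 1), binomMass l m := (Finset.sum_range_succ _ _).symm
    _ ≤ ∑ l ∈ Finset.range i', binomMass l m :=
        Finset.sum_le_sum_of_subset_of_nonneg (Finset.range_mono hlt)
          fun _ _ _ => binomMass_nonneg _ _
    _ ≤ _ := le_add_of_nonneg_right (mul_nonneg h0 (binomMass_nonneg _ _))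

theorem binomMass_symm {m i : ℕ} (h : i ≤ m) : binomMass (m - i) m = binomMass i m := by
  unfold binomMass
  rw [Nat.choose_symm h]

/-- Exchanging successes and failures turns the lower tail into the upper one; `1 - u` splits the
mass at `i` in the complementary way. -/
theorem binomPValue_symm {m i : ℕ} (h : i ≤ m) (u : ℝ) :
    binomPValue m (m - i) (1 - u) = 1 - binomPValue m i u := by
  have hsum : ∑ l ∈ Finset.range (m - i), binomMass l m +
      ∑ l ∈ Finset.range (i + 1), binomMass l m = 1 := by
    have hshift : ∑ x ∈ Finset.range (m - i), binomMass (i + 1 + x) m =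
        ∑ l ∈ Finset.range (m - i), binomMass l m := by
      rw [← Finset.sum_range_reflect (fun l => binomMass l m)]
      refine Finset.sum_congr rfl fun x hx => ?_
      have hx' := Finset.mem_range.1 hx
      rw [show i + 1 + x = m - (m - i - 1 - x) by omega, binomMass_symm (by omega)]
    have htotal := sum_binomMass m
    rw [show m + 1 = (i + 1) + (m - i) by omega, Finset.sum_range_add, hshift] at htotal
    linarith
  rw [Finset.sum_range_succ] at hsum
  unfold binomPValue
  rw [binomMass_symm h]
  linarith

theorem pcstPValue_eq {E p : ℕ} (r : ℕ) (w : Fin E → Fin p → ℝ) (u : Fin p → ℝ) (j : Fin p) :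
    pcstPValue r w u j = binomPValue (E - r + 1 - numZero w j) (numNeg w j) (u j) := rfl

theorem kthLargest_nonneg {n k : ℕ} (hk : 1 ≤ k) (hkn : k ≤ n) {a : Fin n → ℝ}
    (ha : ∀ i, 0 ≤ a i) : 0 ≤ kthLargest a k := by
  rw [le_kthLargest_iff hk hkn, Finset.filter_true_of_mem fun i _ => ha i]
  simpa using hkn

theorem kthLargest_self_le {n : ℕ} (a : Fin n → ℝ) (i : Fin n) : kthLargest a n ≤ a i := by
  have h := (le_kthLargest_iff (a := a) (Nat.one_le_of_lt i.2) le_rfl).1 le_rfl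
  have huniv : (Finset.univ.filter fun i => kthLargest a n ≤ a i) = Finset.univ :=
    Finset.eq_univ_of_card _ (le_antisymm (Finset.card_le_univ _) (by simpa using h))
  simpa using (Finset.ext_iff.1 huniv i).2 (Finset.mem_univ i)

theorem prod_kthLargest_nonneg {E p r : ℕ} (hr : r ≤ E) (w : Fin E → Fin p → ℝ) (j : Fin p) :
    0 ≤ ∏ e ∈ Finset.Icc 1 r, kthLargest (fun e' => |w e' j|) (E - e + 1) := by
  refine Finset.prod_nonneg fun e he => ?_
  obtain ⟨h1, h2⟩ := Finset.mem_Icc.1 he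
  exact kthLargest_nonneg (by omega) (by omega) fun _ => abs_nonneg _

theorem numZero_eq_zero {E p : ℕ} {w : Fin E → Fin p → ℝ} {j : Fin p} (h : ∀ e, w e j ≠ 0) :
    numZero w j = 0 := by
  simp [numZero, h]

/-- A nonzero statistic requires a column without zeros. -/
theorem ne_zero_of_pcstStat_ne_zero {E p r : ℕ} (h1 : 1 ≤ r) (hr : r ≤ E)
    {w : Fin E → Fin p → ℝ} {u : Fin p → ℝ} {j : Fin p} (h : pcstStat r w u j ≠ 0) (e : Fin E) :
    w e j ≠ 0 := by
  intro he
  have hne := right_ne_zero_of_mul h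
  rw [Finset.prod_ne_zero_iff] at hne
  -- The factor with index `1` is the `E`-th largest magnitude, that is, the smallest one.
  have hE := hne 1 (Finset.mem_Icc.2 ⟨le_rfl, h1⟩)
  rw [show E - 1 + 1 = E by omega] at hE
  refine hE (le_antisymm ?_ (kthLargest_nonneg (by omega) le_rfl fun _ => abs_nonneg _))
  simpa [he] using kthLargest_self_le (fun e' => |w e' j|) e

/-- The map that changes the signs of the rows `A` of column `j`, and reflects the `j`-th
auxiliary variable. -/
def flipReflect {E p : ℕ} (A : Finset (Fin E)) (j : Fin p)
    (s : (Fin E → Fin p → ℝ) × (Fin p → ℝ)) : (Fin E → Fin p → ℝ) × (Fin p → ℝ) :=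
  (flipCol A j s.1, fun k => if k = j then 1 - s.2 k else s.2 k)

/-- With `m = E - r + 1` rows in `A` and `b` negatives among them, the column has at least `b`
negatives before the flip and at least `m - b` after it. By monotonicity and symmetry the new
p-value is at least one minus a number that is at most the old p-value, hence above `1/2`. -/
theorem pcstStat_flipReflect {E p r : ℕ} (h1 : 1 ≤ r) (hr : r ≤ E)
    (s : (Fin E → Fin p → ℝ) × (Fin p → ℝ)) {j : Fin p} {A : Finset (Fin E)}
    (hA : A.card = E - r + 1) (hu : s.2 j ∈ Set.Icc (0 : ℝ) 1) (h : 0 < pcstStat r s.1 s.2 j) :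
    pcstStat r (flipReflect A j s).1 (flipReflect A j s).2 =
      Function.update (pcstStat r s.1 s.2) j (-pcstStat r s.1 s.2 j) := by
  obtain ⟨w, u⟩ := s
  simp only [flipReflect] at *
  ext k
  by_cases hk : k = j
  · subst hk
    rw [Function.update_self]
    have hne := ne_zero_of_pcstStat_ne_zero h1 hr h.ne'
    have hne' : ∀ e, flipCol A k w e k ≠ 0 := fun e => by
      rw [← abs_ne_zero, abs_flipCol, abs_ne_zero]; exact hne e
    have hprod := prod_kthLargest_nonneg hr w k
    set u' : Fin p → ℝ := fun l => if l = k then 1 - u l else u l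
    have hlt : pcstPValue r w u k < 1 / 2 := by
      by_contra! hge
      have : (SignType.sign (1 / 2 - pcstPValue r w u k) : ℝ) ≤ 0 := by
        rcases hge.eq_or_lt with heq | hlt
        · simp [← heq]
        · rw [sign_neg (by linarith)]; simp
      exact absurd h (not_lt.2 (mul_nonpos_of_nonpos_of_nonneg this hprod))
    have hgt : 1 / 2 < pcstPValue r (flipCol A k w) u' k := by
      -- The column has no zeros, before or after the flip, so the number of trials is `E - r + 1 =
      -- |A|` both times.
      rw [pcstPValue_eq, numZero_eq_zero hne, Nat.sub_zero] at hlt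
      rw [pcstPValue_eq, numZero_eq_zero hne', Nat.sub_zero]
      have hu' : u' k = 1 - u k := by simp [u']
      rw [hu']
      set b := (A.filter fun e => w e k < 0).card with hb
      have hbm : b ≤ E - r + 1 := hA ▸ Finset.card_filter_le _ _
      have hbn : b ≤ numNeg w k :=
        Finset.card_le_card (Finset.filter_subset_filter _ (Finset.subset_univ A))
      have hbn' : E - r + 1 - b ≤ numNeg (flipCol A k w) k := by
        have hsplit := Finset.card_filter_add_card_filter_not (s := A) fun e => w e k < 0
        have : (A.filter fun e => ¬ w e k < 0).card ≤ numNeg (flipCol A k w) k := by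
          refine Finset.card_le_card fun e he => ?_
          obtain ⟨heA, he⟩ := Finset.mem_filter.1 he
          refine Finset.mem_filter.2 ⟨Finset.mem_univ _, ?_⟩
          rw [flipCol_self, if_pos heA, neg_lt_zero]
          exact lt_of_le_of_ne (not_lt.1 he) (hne e).symm
        omega
      calc (1 : ℝ) / 2 < 1 - binomPValue (E - r + 1) b (u k) := by
            have := binomPValue_mono (E - r + 1) hbn hu.1 hu.2
            linarith
        _ = binomPValue (E - r + 1) (E - r + 1 - b) (1 - u k) := (binomPValue_symm hbm _).symm
        _ ≤ _ := binomPValue_mono _ hbn' (by linarith [hu.2]) (by linarith [hu.1])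
    unfold pcstStat
    rw [sign_pos (sub_pos.2 hlt), sign_neg (sub_neg.2 hgt)]
    simp [abs_flipCol]
  · rw [Function.update_of_ne hk]
    unfold pcstStat pcstPValue numNeg numZero
    simp only [flipCol_of_ne _ hk, if_neg hk]

/-! ### Measurability and the uniform auxiliary variables for the partial consistency statistics. -/

theorem measurable_numNeg {E p : ℕ} (j : Fin p) :
    Measurable fun w : Fin E → Fin p → ℝ => numNeg w j := by
  unfold numNeg
  exact measurable_card_filter fun e => measurableSet_lt
    ((measurable_pi_apply j).comp (measurable_pi_apply e)) measurable_const

theorem measurable_numZero {E p : ℕ} (j : Fin p) :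
    Measurable fun w : Fin E → Fin p → ℝ => numZero w j := by
  unfold numZero
  exact measurable_card_filter fun e =>
    ((measurable_pi_apply j).comp (measurable_pi_apply e)) (measurableSet_singleton 0)

theorem measurable_pcstPValue {E p : ℕ} (r : ℕ) (j : Fin p) :
    Measurable fun s : (Fin E → Fin p → ℝ) × (Fin p → ℝ) => pcstPValue r s.1 s.2 j := by
  have hpair : Measurable fun s : (Fin E → Fin p → ℝ) × (Fin p → ℝ) =>
      (numNeg s.1 j, numZero s.1 j) :=
    ((measurable_numNeg j).prodMk (measurable_numZero j)).comp measurable_fst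
  have hF := (measurable_of_countable fun q : ℕ × ℕ =>
      ∑ i ∈ Finset.range q.1, binomMass i (E - r + 1 - q.2)).comp hpair
  have hf :=
    (measurable_of_countable fun q : ℕ × ℕ => binomMass q.1 (E - r + 1 - q.2)).comp hpair
  have hu : Measurable fun s : (Fin E → Fin p → ℝ) × (Fin p → ℝ) => s.2 j :=
    (measurable_pi_apply j).comp measurable_snd
  exact hF.add (hu.mul hf)

theorem measurable_pcstStat {E p r : ℕ} (hr : r ≤ E) :
    Measurable fun s : (Fin E → Fin p → ℝ) × (Fin p → ℝ) => pcstStat r s.1 s.2 := by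
  refine measurable_pi_lambda _ fun j => ?_
  have hent : ∀ e, Measurable fun s : (Fin E → Fin p → ℝ) × (Fin p → ℝ) => |s.1 e j| := fun e =>
    ((measurable_pi_apply j).comp ((measurable_pi_apply e).comp measurable_fst)).abs
  have hsign : Measurable fun s : (Fin E → Fin p → ℝ) × (Fin p → ℝ) =>
      (SignType.sign (1 / 2 - pcstPValue r s.1 s.2 j) : ℝ) :=
    measurable_sign_cast.comp (measurable_const.sub (measurable_pcstPValue r j))
  have hprod : Measurable fun s : (Fin E → Fin p → ℝ) × (Fin p → ℝ) =>
      ∏ e ∈ Finset.Icc 1 r, kthLargest (fun e' => |s.1 e' j|) (E - e + 1) := by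
    refine Finset.measurable_prod _ fun e he => ?_
    obtain ⟨h1, h2⟩ := Finset.mem_Icc.1 he
    exact measurable_kthLargest (by omega) (by omega) hent
  exact hsign.mul hprod

theorem measurable_pcstStat_comp {S : Type*} [MeasurableSpace S] {E p r : ℕ} (hr : r ≤ E)
    {w : S → Fin E → Fin p → ℝ} (hw : Measurable w) {u : S → Fin p → ℝ} (hu : Measurable u) :
    Measurable fun s => pcstStat r (w s) (u s) := by
  have h := (measurable_pcstStat (E := E) (p := p) hr).comp (hw.prodMk hu)
  rwa [Function.comp_def] at h

/-- The law of independent uniform variables on the unit interval. -/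
def uniformLaw (p : ℕ) : Measure (Fin p → ℝ) :=
  Measure.pi fun _ => volume.restrict (Set.Icc (0 : ℝ) 1)

instance : IsProbabilityMeasure (volume.restrict (Set.Icc (0 : ℝ) 1)) := ⟨by simp⟩

instance (p : ℕ) : IsProbabilityMeasure (uniformLaw p) := by
  unfold uniformLaw; infer_instance

theorem uniform_map_one_sub :
    (volume.restrict (Set.Icc (0 : ℝ) 1)).map (fun x => 1 - x) =
      volume.restrict (Set.Icc (0 : ℝ) 1) := by
  have h := (Measure.measurePreserving_sub_left (volume : Measure ℝ) 1).restrict_preimage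
    (measurableSet_Icc (a := (0 : ℝ)) (b := 1))
  have hpre : (fun x : ℝ => 1 - x) ⁻¹' Set.Icc 0 1 = Set.Icc 0 1 := by
    ext x
    simp only [Set.mem_preimage, Set.mem_Icc]
    constructor <;> rintro ⟨h1, h2⟩ <;> constructor <;> linarith
  rw [hpre] at h
  exact h.map_eq

theorem uniformLaw_map_reflect {p : ℕ} (j : Fin p) :
    (uniformLaw p).map (fun u k => if k = j then 1 - u k else u k) = uniformLaw p := by
  let g : Fin p → ℝ → ℝ := fun k x => if k = j then 1 - x else x
  have hg : ∀ k, Measurable (g k) := fun k => by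
    simp only [g]; split_ifs <;> fun_prop
  have hmap : ∀ k, (volume.restrict (Set.Icc (0 : ℝ) 1)).map (g k) =
      volume.restrict (Set.Icc (0 : ℝ) 1) := by
    intro k
    by_cases hk : k = j
    · simp only [g, hk, if_true]; exact uniform_map_one_sub
    · have : g k = id := by ext x; simp [g, hk]
      rw [this, Measure.map_id]
  have hprob : ∀ k, IsProbabilityMeasure ((volume.restrict (Set.Icc (0 : ℝ) 1)).map (g k)) :=
    fun k => by rw [hmap]; infer_instance
  have h := Measure.pi_map_pi (μ := fun _ : Fin p => volume.restrict (Set.Icc (0 : ℝ) 1)) (f := g)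
    fun k => (hg k).aemeasurable
  simp_rw [hmap] at h
  exact h

theorem measurePreserving_flipReflect {E p : ℕ} {Q : Measure (Fin E → Fin p → ℝ)}
    [IsProbabilityMeasure Q] {A : Finset (Fin E)} {j : Fin p} (hQ : Q.map (flipCol A j) = Q) :
    MeasurePreserving (flipReflect A j) (Q.prod (uniformLaw p)) (Q.prod (uniformLaw p)) := by
  refine MeasurePreserving.prod ⟨measurable_flipCol A j, hQ⟩ ⟨?_, uniformLaw_map_reflect j⟩
  refine measurable_pi_lambda _ fun k => ?_
  split_ifs <;> fun_prop

theorem ae_mem_Icc_uniformLaw {E p : ℕ} (Q : Measure (Fin E → Fin p → ℝ))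
    [IsProbabilityMeasure Q] (j : Fin p) :
    ∀ᵐ s ∂Q.prod (uniformLaw p), s.2 j ∈ Set.Icc (0 : ℝ) 1 := by
  have h : ∀ᵐ u ∂uniformLaw p, u j ∈ Set.Icc (0 : ℝ) 1 :=
    Measure.tendsto_eval_ae_ae.eventually (ae_restrict_mem measurableSet_Icc)
  exact Measure.quasiMeasurePreserving_snd.ae h

/-! ### Null e-values of one run -/

open Classical in
theorem sum_integral_eValue_cstStat_le {Ω : Type*} [MeasurableSpace Ω] {μ : Measure Ω}
    [IsProbabilityMeasure μ] {E p : ℕ} {P : Fin E → Measure ((Fin p → ℝ) × ℝ)}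
    [∀ e, IsFiniteMeasure (P e)] (α : ℝ) {w : Ω → Fin E → Fin p → ℝ} (hw : Measurable w)
    (hflip : FlipInvariant P (μ.map w)) :
    ∑ j ∈ Finset.univ.filter (· ∈ {j | CstNull P j}), ∫ ω, eValue α (cstStat (w ω)) j ∂μ ≤ p := by
  have hprob : IsProbabilityMeasure (μ.map w) := Measure.isProbabilityMeasure_map hw.aemeasurable
  have h := sum_integral_eValue_le (μ.map w) α measurable_cstStat
    (Finset.univ.filter (· ∈ {j | CstNull P j})) fun j hj => by
      obtain ⟨e, he⟩ : CstNull P j := (Finset.mem_filter.1 hj).2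
      exact ⟨flipCol {e} j, ⟨measurable_flipCol _ _, hflip e j he⟩,
        Filter.Eventually.of_forall fun s hs => cstStat_flipCol e hs⟩
  refine (Finset.sum_congr rfl fun j _ => ?_).trans_le h
  exact (integral_map hw.aemeasurable
    (measurable_eValue α measurable_cstStat j).aestronglyMeasurable).symm

open Classical in
theorem sum_integral_eValue_pcstStat_le {Ω : Type*} [MeasurableSpace Ω] {μ : Measure Ω}
    [IsProbabilityMeasure μ] {E p r : ℕ} (h1 : 1 ≤ r) (hr : r ≤ E)
    {P : Fin E → Measure ((Fin p → ℝ) × ℝ)} [∀ e, IsFiniteMeasure (P e)] (α : ℝ)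
    {w : Ω → Fin E → Fin p → ℝ} (hw : Measurable w) (hflip : FlipInvariant P (μ.map w))
    {u : Ω → Fin p → ℝ} (hu : Measurable u)
    (hlaw : μ.map (fun ω => (w ω, u ω)) = (μ.map w).prod (uniformLaw p)) :
    ∑ j ∈ Finset.univ.filter (· ∈ {j | PcstNull P r j}),
      ∫ ω, eValue α (pcstStat r (w ω) (u ω)) j ∂μ ≤ p := by
  have hprob : IsProbabilityMeasure (μ.map w) := Measure.isProbabilityMeasure_map hw.aemeasurable
  have h := sum_integral_eValue_le ((μ.map w).prod (uniformLaw p)) α (measurable_pcstStat hr)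
    (Finset.univ.filter (· ∈ {j | PcstNull P r j})) fun j hj => by
      have hnull : PcstNull P r j := (Finset.mem_filter.1 hj).2
      unfold PcstNull at hnull
      rw [Set.ncard_eq_toFinset_card'] at hnull
      -- More than `E - r` null rows leave room for exactly `E - r + 1`, the number of binomial
      -- trials.
      obtain ⟨A, hAsub, hA⟩ := Finset.exists_subset_card_eq (Nat.succ_le_of_lt hnull)
      refine ⟨flipReflect A j, measurePreserving_flipReflect
        (hflip.map_flipCol j A fun e he => by simpa using hAsub he), ?_⟩
      filter_upwards [ae_mem_Icc_uniformLaw (μ.map w) j] with s hs hpos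
      exact pcstStat_flipReflect h1 hr s hA hs hpos
  -- The bound is proved on the product space, where `flipReflect` acts, and is pulled back along
  -- `(w, u)`.
  rw [← hlaw] at h
  refine (Finset.sum_congr rfl fun j _ => ?_).trans_le h
  exact (integral_map (hw.prodMk hu).aemeasurable
    (measurable_eValue α (measurable_pcstStat hr) j).aestronglyMeasurable).symm

end MEKF

end

theorem theoremA3 {Ω : Type*} [MeasurableSpace Ω] (μ : Measure Ω) [IsProbabilityMeasure μ]
    (E p M : ℕ) (hE : 1 ≤ E) (hM : 1 ≤ M)
    (αkn αebh : ℝ) (hkn : αkn ∈ Set.Ioo (0 : ℝ) 1) (hebh : αebh ∈ Set.Ioo (0 : ℝ) 1)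
    -- the environments: sample sizes and laws of `(X, Y)`
    (n : Fin E → ℕ)
    (P : Fin E → Measure ((Fin p → ℝ) × ℝ)) [∀ e, IsProbabilityMeasure (P e)]
    -- the knockoff mechanisms, possibly different in different runs
    (K : ∀ (_ : Fin M) (e : Fin E), Kernel (MEKF.CovMat (n e) p) (MEKF.CovMat (n e) p))
    [∀ m e, IsMarkovKernel (K m e)]
    (hK : ∀ m e, MEKF.IsKnockoffKernel (Measure.pi fun _ : Fin (n e) => (P e).fst) (K m e))
    -- the data sets and, for each run, the knockoff matrices; environments are independent
    (Z : ∀ e : Fin E, Ω → MEKF.EnvData (n e) p) (hZ : ∀ e, Measurable (Z e))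
    (Xt : ∀ (_ : Fin M) (e : Fin E), Ω → MEKF.CovMat (n e) p) (hXt : ∀ m e, Measurable (Xt m e))
    (hlaw : ∀ m, μ.map (fun ω e => ((Z e ω, Xt m e ω) : MEKF.AugData (n e) p)) =
      Measure.pi fun e => MEKF.augLaw (n e) (P e) (K m e))
    -- the multi-environment statistics of each run: valid, or computed from data and knockoffs
    -- by a map with the flip-sign property
    (W : Fin M → Ω → Fin E → Fin p → ℝ) (hWmeas : ∀ m, Measurable (W m))
    (hW : ∀ m, MEKF.IsValidStat μ P (W m) ∨
      ∃ F : (∀ e, MEKF.AugData (n e) p) → Fin E → Fin p → ℝ,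
        Measurable F ∧ MEKF.FlipSign F ∧ ∀ ω, W m ω = F fun e => (Z e ω, Xt m e ω)) :
    MEKF.ControlsFDR μ {j | MEKF.CstNull P j}
      (fun ω => MEKF.derandSelect αkn αebh fun m => MEKF.cstStat (W m ω)) αebh ∧
    ∀ r : ℕ, 1 ≤ r → r ≤ E →
      -- the auxiliary variables of each run: i.i.d. uniform on `[0, 1]`, independent of `W`
      ∀ U : Fin M → Fin p → Ω → ℝ, (∀ m j, Measurable (U m j)) →
        (∀ m j, μ.map (U m j) = volume.restrict (Set.Icc (0 : ℝ) 1)) →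
        (∀ m, iIndepFun (U m) μ) →
        (∀ m, IndepFun (W m) (fun ω j => U m j ω) μ) →
        MEKF.ControlsFDR μ {j | MEKF.PcstNull P r j}
          (fun ω => MEKF.derandSelect αkn αebh fun m => MEKF.pcstStat r (W m ω) fun j => U m j ω)
          αebh := by
  have hflip : ∀ m, MEKF.FlipInvariant P (μ.map (W m)) := by
    intro m
    rcases hW m with h | ⟨F, hF, hFs, hWF⟩
    · exact h.flipInvariant (hWmeas m)
    · have hdata : Measurable fun ω e => ((Z e ω, Xt m e ω) : MEKF.AugData (n e) p) :=
        measurable_pi_lambda _ fun e => (hZ e).prodMk (hXt m e)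
      -- Only the joint law of data and knockoffs within run `m` is used.
      have hWmap : μ.map (W m) =
          (Measure.pi fun e => MEKF.augLaw (n e) (P e) (K m e)).map F := by
        rw [← hlaw m, Measure.map_map hF hdata]
        exact congrArg (fun f => μ.map f) (funext hWF)
      rw [hWmap]
      exact hFs.flipInvariant (K m) (hK m) hF
  have hcst : ∀ m, Measurable fun ω => MEKF.cstStat (W m ω) := fun m =>
    MEKF.measurable_cstStat.comp (hWmeas m)
  refine ⟨MEKF.controlsFDR_derandSelect μ hM hebh.1 _ (V := fun m ω => MEKF.cstStat (W m ω)) hcst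
    fun m => MEKF.sum_integral_eValue_cstStat_le αkn (hWmeas m) (hflip m), ?_⟩
  intro r h1 hr U hU hUlaw hUindep hWU
  have hUm : ∀ m, Measurable fun ω j => U m j ω := fun m => measurable_pi_lambda _ (hU m)
  have hV : ∀ m, Measurable fun ω => MEKF.pcstStat r (W m ω) fun j => U m j ω := fun m =>
    MEKF.measurable_pcstStat_comp hr (hWmeas m) (hUm m)
  -- Independence of `W` and `U`, together with mutual independence of the `U_j`, gives the product
  -- law on which column flips and reflections act separately.
  have hWUlaw : ∀ m, μ.map (fun ω => (W m ω, fun j => U m j ω)) =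
      (μ.map (W m)).prod (MEKF.uniformLaw p) := fun m => by
    rw [(hWU m).map_prod_eq_prod_map_map (hWmeas m).aemeasurable (hUm m).aemeasurable,
      (hUindep m).map_fun_eq_pi_map fun j => (hU m j).aemeasurable,
      MEKF.uniformLaw, funext (hUlaw m)]
  refine MEKF.controlsFDR_derandSelect μ hM hebh.1 _
    (V := fun m ω => MEKF.pcstStat r (W m ω) fun j => U m j ω) hV fun m =>
    MEKF.sum_integral_eValue_pcstStat_le h1 hr αkn (hWmeas m) (hflip m) (hUm m)
      (hWUlaw m)
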